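/- **Setting.** Let $N\ge 1$, let $p$ be a prime with $p\nmid N$, let $\alpha\ge 1$, and let $K$ be a field, complete for an ultrametric absolute value that extends the one of $\mathbb{Q}_p$, which contains a primitive $N$-th root of unity $\xi$ (for instance $K=\mathrm{Frac}\,W(\mathbb{F}_q)$). Put $z_i=\xi^i$ for $i\in\mathbb{Z}/N$, $|x|=p^{-v_p(x)}$, and $\mathbb{Z}_p^{(N)}=\varprojlim_l\mathbb{Z}/Np^l\mathbb{Z}\simeq\mathbb{Z}/N\times\mathbb{Z}_p$. Fix a word $$w=e_0^{s_{d+1}-1}e_{z_{i_{d+1}}}\cdots e_0^{s_1-1}e_{z_{i_1}}\qquad(d\ge 0,\ s_j\ge 1)$$ on the letters $e_0,e_{z_i}$; its depth is $d+1$ and its weight is $s=s_1+\dots+s_{d+1}$. **Functions.** $\mathrm{LAE}^{\mathrm{reg}}$ is the space of functions $c:\mathbb{Z}_p^{(N)}\to K$ such that for each $r\in\{0,\dots,p^\alpha-1\}$ one has $c(n)=\sum_{l\ge 0}\sum_i c^{(l,i)}(r)\,\xi^{-in}(n-r)^l$ for $|n-r|_p\le p^{-\alpha}$, where each sequence $b_l=c^{(l,i)}(r)$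 satisfies $|b_l|\le p^{\kappa+\frac{\kappa'}{\log p}\log(l+\kappa'')+(\alpha-1)l}$ for some $\kappa,\kappa',\kappa''>0$. $\mathrm{LAE}^{\mathrm{pol}}$ is the space of sequences $(c_n)_{n\ge1}$ with such expansions, except that the one at $0$ is allowed to start at $l=-1$; the regularization of $c\in\mathrm{LAE}^{\mathrm{pol}}$ is $c-\sum_i c^{(-1,i)}(0)f_i\in\mathrm{LAE}^{\mathrm{reg}}$, with $f_i(n)=\mathbf{1}_{p^\alpha\mid n}\,\xi^{-in}/n$. **Regularized iterated integrals.** The letter $e_0$ stands for $p^\alpha\frac{dz}{z}$ and $e_{z_i}$ for $p^\alpha\frac{dz}{z-z_i}$. The regularized integral $\int_{\mathrm{reg}}w\in\mathrm{LAE}^{\mathrm{reg}}$ is defined letter by letter from the right: starting from the power series $1$ for the empty word, multiply the current power series by the form of the next letter, integrate from $0$, take the sequence of coefficients of $z^n$ ($n\ge1$), and regularize it to a function $F\in\mathrm{LAE}^{\mathrm{reg}}$; the next power series is $\sum_{n\ge 1}F(n)z^n$. **Pieces.** If $F=\int_{\mathrm{reg}}w'$ is known, the multiplication of $\sum_{n\ge1}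 F(n)z^n$ by $\frac{z}{z-z_{i_0}}$ is computed on the class of $r_0$ modulo $p^\alpha$ by writing $n=p^\alpha u+r_0$ and splitting $-\sum_{0<n'<n}\xi^{-i_0(n-n')}F(n')$, $n'=p^\alpha u'+r$, into three parts: the part $r=0$; the part $1\le r\le p^\alpha-1$, $0\le u'<u$; and, if $r_0\ne 0$, the part $1\le r<r_0$, $u'=u$. In the first two, insert the expansions of $F$ at $r$ and write $\sum_{u'}u'^m\zeta^{u'}=\zeta^uP(u)+q$ with $\zeta=\xi^{(i_0-j)p^\alpha}$, $P$ a polynomial, $q$ a constant and $P(0)=0$ when $\zeta=1$ and the sum is over $0\le u'<u$ (the $u'=0$ term, if not in the range, is put in $q$; the $u'=u$ term, if in the range, is put in $P$); the $\zeta^uP(u)$ part contributes to the $j$-th exponential and the constant $q$ to the $i_0$-th one. The contribution of a coefficient of index $m$ of $F$ to a coefficient of index $l'$ then carries a factor $(p^\alpha)^L$ with $L=m-l'\ge-1$; in the third part no $L$ appears, and $l'=m$. Multiplying next by $(p^\alpha)^{s}/n^{s}$, and dropping the polar terms at $0$, corresponds to the block $e_0^{s-1}e_{z_{i_0}}$.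 Iterating from $w$ down to words of depth one, and choosing at each of the $d$ steps one of the three parts, each coefficient $(\int_{\mathrm{reg}}w)^{(l,i)}(r)$ is a sum of contributions indexed by paths $\gamma$ from the root to the leaves of a tree $T_r$ whose root is labelled by $r$ (vertices are labelled by $0$ or by a non-zero class; the arrows are the three parts); for $r\neq0$, let $\gamma_0$ be the path that takes the third part at each step. For $\Sigma L\in\mathbb{Z}$, $\Sigma L\geq -d$, let $\int_{\mathrm{reg}}(w,\gamma,\Sigma L)^{(l,i)}(r)$ be the finite sum of the terms of $\gamma$ for which the sum of all the indices $L$ is $\Sigma L$. Let $\kappa_2=2$, $\kappa_p=1$ for $p\ne2$, and for $e\in\mathbb{Z}$ $$\Sigma L_0^p(e)=\frac{e+d+\frac{d}{\log p}\log(\kappa_p(l+s+1))}{1-\frac{1}{\kappa_p\log p}},\qquad \Sigma L_0(e)=\frac{e+d+\frac{d}{\log 2}\log(2(l+s+1))}{1-\frac1{\log 4}}.$$ **Statement.** Let $r\in\{0,\dots,p^\alpha-1\}$, $\gamma\neq\gamma_0$ a path of $T_r$ from the root to the leaves, $\Sigma L\ge-d$, $e\in\mathbb{Z}$, $l\in\mathbb{N}$,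 $i\in\mathbb{Z}/N$. i) If $\Sigma L\ge\Sigma L_0^p(e)$, then $v_p\big(\int_{\mathrm{reg}}(w,\gamma,\Sigma L)^{(l,i)}(r)\big)\ge e-(\alpha-1)l$. ii) If $\Sigma L<\Sigma L_0^p(e)$, or if $e\ge0$ and $\Sigma L<\Sigma L_0(e)$, and if moreover $p>\max(\Sigma L_0^p(e)+s+l,\,2\Sigma L_0^p(e)+3)$, then $v_p\big(\int_{\mathrm{reg}}(w,\gamma,\Sigma L)^{(l,i)}(r)\big)\ge s-d-(\alpha-1)l$. iii) There is $p_0$, depending only on $N$ and on the word $w$ (that is, on $d$, the $s_j$ and the $i_j$), such that for all primes $p\ge p_0$ with $p\nmid N$, all $\alpha\ge1$ and all $K,\xi$ as above, $\int_{\mathrm{reg}}w$ is defined and, for all $n\in\mathbb{Z}_p^{(N)}$, $$v_p\Big(\big(\textstyle\int_{\mathrm{reg}}w\big)(n)\Big)\ \ge\ s-d .$$ -/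

import Mathlib

namespace RegIter

open Finset PowerSeries

/-- The letters of the alphabet `e_Z`: `e0` is `e_0`, and `root i` is `e_{z_i}` with `z_i = ξ ^ i`.
The index `i` is taken in `{0, …, N - 1}`, i.e. modulo `N` (`0` stands for `N`, as `ξ ^ N = 1`). -/
inductive Letter (N : ℕ) : Type
  | e0 : Letter N
  | root (i : Fin N) : Letter N

/-- `[(s_n, i_n), …, (s_1, i_1)]` encodes the word
`e_0 ^ (s_n - 1) e_{z_{i_n}} ⋯ e_0 ^ (s_1 - 1) e_{z_{i_1}}`.  Every non-empty word on `e_Z` that does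
not end with `e_0` is of this form in a unique way; the length of the list is the depth. -/
abbrev Blocks (N : ℕ) : Type := List (ℕ+ × Fin N)

/-- The word, as a list of letters read from left to right. -/
def Blocks.word {N : ℕ} (w : Blocks N) : List (Letter N) :=
  w.flatMap fun b => List.replicate ((b.1 : ℕ) - 1) Letter.e0 ++ [Letter.root b.2]

/-- The weight (number of letters) `s_n + ⋯ + s_1`. -/
def Blocks.weight {N : ℕ} (w : Blocks N) : ℕ := (w.map fun b => (b.1 : ℕ)).sum

/-- `ℤ_p^{(N)} = lim ℤ / N p ^ l ℤ`, which is `ℤ / N × ℤ_p` since `p` does not divide `N`.  A natural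
number `n` is seen in it through its natural cast, i.e. as the pair `(n mod N, n)`. -/
abbrev ZpN (p N : ℕ) [Fact p.Prime] : Type := ZMod N × ℤ_[p]

section Field

variable (p α : ℕ) [Fact p.Prime] {N : ℕ} {K : Type*} [NormedField K] [NormedAlgebra ℚ_[p] K] (ξ : K)

/-! ### Locally analytic-exponential functions -/

/-- The growth condition `|b_l| ≤ p ^ (κ + κ' log (l + κ'') / log p + (α - 1) l)`. -/
def SeqGrowth (b : ℕ → K) : Prop :=
  ∃ κ κ' κ'' : ℝ, 0 < κ ∧ 0 < κ' ∧ 0 < κ'' ∧ ∀ l : ℕ,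
    ‖b l‖ ≤ (p : ℝ) ^ (κ + κ' / Real.log p * Real.log (l + κ'') + ((α : ℝ) - 1) * l)

/-- `C r i l` is the coefficient `c^{(l,i)}(r)` of the function `F` on `ℤ_p^{(N)}`, for
`r ∈ {0, …, p ^ α - 1}`: on the disk `|n - r| ≤ p ^ (-α)` one has
`F(n) = ∑_l ∑_i c^{(l,i)}(r) ξ ^ (-i n) (n - r) ^ l`. -/
def IsExpansion (F : ZpN p N → K) (C : ℕ → Fin N → ℕ → K) : Prop :=
  (∀ r < p ^ α, ∀ i, SeqGrowth p α (C r i)) ∧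
  ∀ r < p ^ α, ∀ n : ZpN p N, ‖n.2 - (r : ℤ_[p])‖ ≤ (p : ℝ) ^ (-(α : ℤ)) →
    HasSum (fun l : ℕ => ∑ i : Fin N, C r i l * (ξ ^ (i : ℕ))⁻¹ ^ n.1.val *
      algebraMap ℚ_[p] K ((n.2 - (r : ℤ_[p]) : ℤ_[p]) : ℚ_[p]) ^ l) (F n)

/-- The space `LAE^reg` of functions on `ℤ_p^{(N)}`. -/
def IsLAE (F : ZpN p N → K) : Prop := ∃ C, IsExpansion p α ξ F C

/-- The sequence `(g_n)_{n ≥ 1}` is in the space `LAE^pol`: it has expansions as above on the disks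
around `1, …, p ^ α - 1`, and on the disk around `0` an expansion that starts at `l = -1`, with the
polar coefficients `a i = g^{(-1,i)}(0)`. -/
def IsPolExpansion (g : ℕ → K) (a : Fin N → K) (C : ℕ → Fin N → ℕ → K) : Prop :=
  (∀ r < p ^ α, ∀ i, SeqGrowth p α (C r i)) ∧
  ∀ r < p ^ α, ∀ n : ℕ, 1 ≤ n → n ≡ r [MOD p ^ α] →
    HasSum (fun l : ℕ => ∑ i : Fin N, C r i l * (ξ ^ (i : ℕ))⁻¹ ^ n * ((n : K) - r) ^ l)
      (g n - if r = 0 then ∑ i : Fin N, a i * (ξ ^ (i : ℕ))⁻¹ ^ n * (n : K)⁻¹ else 0)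

/-- The function `f_i : n ↦ 1_{p ^ α ∣ n} ξ ^ (-i n) / n`. -/
noncomputable def polar (i : Fin N) (n : ℕ) : K :=
  if p ^ α ∣ n then (ξ ^ (i : ℕ))⁻¹ ^ n / n else 0

/-- `F` is the regularization `g - ∑_i g^{(-1,i)}(0) f_i` of `g ∈ LAE^pol`, extended to
`ℤ_p^{(N)}`. -/
def IsRegularization (g : ℕ → K) (F : ZpN p N → K) : Prop :=
  ∃ a C, IsPolExpansion p α ξ g a C ∧ IsLAE p α ξ F ∧
    ∀ n : ℕ, 1 ≤ n → F (n : ZpN p N) = g n - ∑ i : Fin N, a i * polar p α ξ i n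

/-! ### Regularized iterated integrals -/

/-- The differential form of a letter, divided by `dz / z`: `e_0` stands for `p ^ α dz / z`, and
`e_{z_i}` for `p ^ α dz / (z - z_i)`. -/
noncomputable def form : Letter N → K⟦X⟧
  | Letter.e0 => C ((p : K) ^ α)
  | Letter.root i => C ((p : K) ^ α) * (X * (X - C (ξ ^ (i : ℕ)))⁻¹)

/-- The coefficient of `z ^ n`, `n ≥ 1`, in `∫_0^z f dz / z`. -/
noncomputable def integralCoeff (f : K⟦X⟧) (n : ℕ) : K := coeff n f / n

/-- The power series `∑_{n ≥ 1} F(n) z ^ n`. -/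
noncomputable def series (F : ZpN p N → K) : K⟦X⟧ :=
  PowerSeries.mk fun n => if n = 0 then 0 else F (n : ZpN p N)

/-- `IsRegInt p α ξ w F`: the function `F` on `ℤ_p^{(N)}` is the regularized iterated integral of the
non-empty word `w` (the leftmost letter is integrated last).  The integral of a single letter is
regularized; for a word `e w`, the regularized integral `G` of `w` is seen as the power series
`∑_{n ≥ 1} G(n) z ^ n`, multiplied by the form of `e`, integrated, and regularized. -/
def IsRegInt : List (Letter N) → (ZpN p N → K) → Prop
  | [], _ => False
  | [e], F => IsRegularization p α ξ (integralCoeff (form p α ξ e)) F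
  | e :: e' :: w, F => ∃ G : ZpN p N → K, IsRegInt (e' :: w) G ∧
      IsRegularization p α ξ (integralCoeff (form p α ξ e * series p G)) F

end Field

/-! ### Twisted power sums -/

section PowerSums

variable {K : Type*} [Field K]

/-- `∑_{0 ≤ k < u} ζ ^ k k ^ m = ζ ^ u P(u) - P(0)` for all `u`, with `P(0) = 0` if `ζ = 1`. -/
def IsPowerSumPoly (ζ : K) (m : ℕ) (P : Polynomial K) : Prop :=
  (ζ = 1 → P.eval 0 = 0) ∧
  ∀ u : ℕ, ∑ k ∈ range u, ζ ^ k * (k : K) ^ m = ζ ^ u * P.eval (u : K) - P.eval 0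

theorem exists_isPowerSumPoly [CharZero K] (ζ : K) (m : ℕ) : ∃ P, IsPowerSumPoly ζ m P := by
  suffices h : ∃ P : Polynomial K, (ζ = 1 → P.eval 0 = 0) ∧
      ∀ u : ℕ, ζ * P.eval ((u : K) + 1) - P.eval (u : K) = (u : K) ^ m by
    obtain ⟨P, h0, hP⟩ := h
    refine ⟨P, h0, fun u => ?_⟩
    induction u with
    | zero => simp
    | succ u ih =>
      rw [sum_range_succ, ih, ← hP u]
      push_cast
      ring
  by_cases hζ : ζ = 1
  · subst hζ
    refine ⟨∑ i ∈ range (m + 1), Polynomial.C (algebraMap ℚ K (bernoulli i * ((m + 1).choose i) / (m + 1))) *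
      Polynomial.X ^ (m + 1 - i), fun _ => ?_, fun u => ?_⟩
    · rw [Polynomial.eval_finsetSum]
      refine sum_eq_zero fun i hi => ?_
      have : m + 1 - i ≠ 0 := by have := mem_range.1 hi; omega
      simp [this]
    · have key : ∀ v : ℕ, (∑ i ∈ range (m + 1), Polynomial.C (algebraMap ℚ K
          (bernoulli i * ((m + 1).choose i) / (m + 1))) * Polynomial.X ^ (m + 1 - i)).eval (v : K) =
          ∑ k ∈ range v, (k : K) ^ m := by
        intro v
        have h := congrArg (algebraMap ℚ K) (sum_range_pow v m)
        simp only [map_sum, map_pow, map_natCast] at h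
        rw [h, Polynomial.eval_finsetSum]
        refine sum_congr rfl fun i _ => ?_
        simp
        ring
      have h1 := key (u + 1)
      rw [sum_range_succ (fun k : ℕ => (k : K) ^ m), ← key u, Nat.cast_succ] at h1
      rw [one_mul, h1]
      ring
  · have hζ' : ζ - 1 ≠ 0 := sub_ne_zero.2 hζ
    suffices h : ∃ P : Polynomial K, ∀ x : K, ζ * P.eval (x + 1) - P.eval x = x ^ m by
      obtain ⟨P, hP⟩ := h
      exact ⟨P, fun h => absurd h hζ, fun u => hP u⟩
    induction m using Nat.strong_induction_on with
    | _ m ih =>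
      choose Q hQ using ih
      refine ⟨Polynomial.C (ζ - 1)⁻¹ * (Polynomial.X ^ m - Polynomial.C ζ *
        ∑ j ∈ (range m).attach, Polynomial.C ((m.choose j : ℕ) : K) * Q j (mem_range.1 j.2)), fun x => ?_⟩
      have h1 : (x + 1) ^ m = ∑ j ∈ (range m).attach, x ^ (j : ℕ) * (m.choose j : K) + x ^ m := by
        rw [sum_attach (range m) fun j => x ^ j * (m.choose j : K), add_pow, sum_range_succ]
        simp
      have h2 : ∑ j ∈ (range m).attach, x ^ (j : ℕ) * (m.choose j : K) =
          ζ * ∑ j ∈ (range m).attach, (m.choose j : K) * (Q j (mem_range.1 j.2)).eval (x + 1) -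
          ∑ j ∈ (range m).attach, (m.choose j : K) * (Q j (mem_range.1 j.2)).eval x := by
        rw [mul_sum, ← sum_sub_distrib]
        refine sum_congr rfl fun j _ => ?_
        rw [← hQ j (mem_range.1 j.2) x]
        ring
      simp only [Polynomial.eval_mul, Polynomial.eval_sub, Polynomial.eval_C, Polynomial.eval_pow,
        Polynomial.eval_X, Polynomial.eval_finsetSum]
      rw [h1, h2]
      field_simp
      ring

open Classical in
/-- The polynomial `P` of `IsPowerSumPoly` (it exists, and it is unique if `ζ` is a root of unity). -/
noncomputable def powerSumPoly (ζ : K) (m : ℕ) : Polynomial K :=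
  if h : ∃ P, IsPowerSumPoly ζ m P then h.choose else 0

theorem isPowerSumPoly_powerSumPoly [CharZero K] (ζ : K) (m : ℕ) :
    IsPowerSumPoly ζ m (powerSumPoly ζ m) := by
  have h := exists_isPowerSumPoly ζ m
  rw [powerSumPoly, dif_pos h]
  exact h.choose_spec

/-- The three ranges of summation that occur:
`0 < k < u`, `0 < k ≤ u` and `0 ≤ k < u`. -/
inductive SumRange : Type
  | oo : SumRange
  | oc : SumRange
  | co : SumRange

/-- A polynomial `P` and a constant `q` such that the sum of `ζ ^ k k ^ m` over the range is
`ζ ^ u P(u) + q` (for `u ≥ 1` if the range is `0 < k < u`). -/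
noncomputable def rangeSum (ρ : SumRange) (ζ : K) (m : ℕ) : Polynomial K × K :=
  match ρ with
  | SumRange.oo => (powerSumPoly ζ m, -(powerSumPoly ζ m).eval 0 - (0 : K) ^ m)
  | SumRange.oc => (powerSumPoly ζ m + Polynomial.X ^ m, -(powerSumPoly ζ m).eval 0 - (0 : K) ^ m)
  | SumRange.co => (powerSumPoly ζ m, -(powerSumPoly ζ m).eval 0)

end PowerSums

/-! ### The pieces indexed by a path and by the sum of the indices `L` -/

section Pieces

variable (p α : ℕ) {N : ℕ} {K : Type*} [Field K] (ξ : K)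

/-- The arrows of the trees: `toZero` goes to a vertex labelled `0`, while `toNonzero` and `carry` go to
a vertex that stands for all the classes in `{1, …, p ^ α - 1}`.  The arrow `carry` only starts at
vertices of the latter type. -/
inductive Arrow : Type
  | toZero : Arrow
  | toNonzero : Arrow
  | carry : Arrow

/-- The contribution of the term `ξ ^ (-j n) (p ^ α k) ^ m` to the coefficient of
`ξ ^ (-i n) (p ^ α u) ^ l` in `ξ ^ (-i₀ n) ∑_k ξ ^ (i₀ p ^ α k) ξ ^ (-j p ^ α k) (p ^ α k) ^ m`, with
`n = p ^ α u + r₀` and `k` in the range `ρ` with end point `u`, up to the factor `p ^ (α (m - l))`. -/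
noncomputable def kernel (ρ : SumRange) (i₀ : Fin N) (r₀ : ℕ) (i j : Fin N) (l m : ℕ) : K :=
  (if i = j then ξ ^ (((j : ℤ) - (i₀ : ℤ)) * (r₀ : ℤ)) *
      (rangeSum ρ (ξ ^ (((i₀ : ℤ) - (j : ℤ)) * (p : ℤ) ^ α)) m).1.coeff l else 0) +
  (if i = i₀ ∧ l = 0 then (rangeSum ρ (ξ ^ (((i₀ : ℤ) - (j : ℤ)) * (p : ℤ) ^ α)) m).2 else 0)

/-- One step of the computation of the expansion of `f z / (z - z_{i₀})` on the class of `r₀`.  Here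
`T t r j m` is the piece with sum of indices `t` of the `(m, j)`-th coefficient of `f` at `r`, and
`t + len` bounds the index `L = m - l ≥ -1` of the step from above. -/
noncomputable def step (a : Arrow) (len : ℕ) (T : ℤ → ℕ → Fin N → ℕ → K) (i₀ : Fin N)
    (t : ℤ) (r₀ : ℕ) (i : Fin N) (l : ℕ) : K :=
  match a with
  | Arrow.toZero => -∑ m ∈ Icc (l - 1) (t + l + len).toNat, ((p : K) ^ α) ^ ((m : ℤ) - l) *
      ∑ j : Fin N, kernel p α ξ (if r₀ = 0 then SumRange.oo else SumRange.oc) i₀ r₀ i j l m *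
        T (t - ((m : ℤ) - l)) 0 j m
  | Arrow.toNonzero => -∑ m ∈ Icc (l - 1) (t + l + len).toNat, ((p : K) ^ α) ^ ((m : ℤ) - l) *
      ∑ r ∈ Ico 1 (p ^ α), ∑ j : Fin N, ξ ^ (((i₀ : ℤ) - (j : ℤ)) * (r : ℤ)) *
        kernel p α ξ SumRange.co i₀ r₀ i j l m * T (t - ((m : ℤ) - l)) r j m
  | Arrow.carry => -∑ r ∈ Ico 1 r₀, ξ ^ (((i : ℤ) - (i₀ : ℤ)) * ((r₀ : ℤ) - (r : ℤ))) * T t r i l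

/-- `piece p α ξ w γ t r i l` is the coefficient `(∫_reg (w, γ, ΣL))^{(l,i)}(r)`, where `γ` is the list
of arrows of a path that starts at the root, and `t = ΣL`.  A leaf corresponds to a word of depth one.
For a word `e_0 ^ (s - 1) e_{z_{i₀}} w'`, the multiplication by `z / (z - z_{i₀})` (a `step`) is followed
by `s` regularized integrations of `p ^ α dz / z`, i.e. the division by `n ^ s`, the polar part at `0`
being removed. -/
noncomputable def piece : Blocks N → List Arrow → ℤ → ℕ → Fin N → ℕ → K
  | [(s, i₀)], [], t, r, i, l =>
      if t = 0 ∧ r ≠ 0 ∧ i = i₀ then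
        -((p : K) ^ α) ^ (s : ℕ) * ((Ring.choose (-(s : ℤ)) l : ℤ) : K) * ((r : K) ^ ((s : ℕ) + l))⁻¹
      else 0
  | (s, i₀) :: b :: w, a :: γ, t, r, i, l =>
      if r = 0 then
        ((p : K) ^ α) ^ (s : ℕ) * step p α ξ a γ.length (piece (b :: w) γ) i₀ t 0 i (l + s)
      else
        ((p : K) ^ α) ^ (s : ℕ) * ∑ l₁ ∈ range (l + 1), ((Ring.choose (-(s : ℤ)) (l - l₁) : ℤ) : K) *
          ((r : K) ^ (l - l₁ + (s : ℕ)))⁻¹ * step p α ξ a γ.length (piece (b :: w) γ) i₀ t r i l₁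
  | _, _, _, _, _, _ => 0

end Pieces

/-- `2` if `p = 2`, and `1` otherwise. -/
def kappa (p : ℕ) : ℝ := if p = 2 then 2 else 1

/-- The threshold `ΣL_0^p(e)` (for the word of depth `d + 1` and weight `s`, and the index `l`). -/
noncomputable def thresholdAt (p d s l : ℕ) (e : ℤ) : ℝ :=
  (e + d + d / Real.log p * Real.log (kappa p * (l + s + 1))) / (1 - 1 / (kappa p * Real.log p))

/-- The threshold `ΣL_0(e)`. -/
noncomputable def threshold (d s l : ℕ) (e : ℤ) : ℝ :=
  (e + d + d / Real.log 2 * Real.log (2 * (l + s + 1))) / (1 - 1 / Real.log 4)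

end RegIter

/-!
Write `v` for the valuation on `K`, and `S`, `d + 1` for the weight and the depth of the word.

*Pieces.* A step of the computation multiplies the coefficient of index `m` by `p ^ (α (m - l))` and
by the coefficient of degree `l` of a power sum polynomial. By Faulhaber's formula, the von
Staudt–Clausen theorem, and the fact that `ζ - 1` is a unit for the roots of unity `ζ ≠ 1` that occur,
the latter has valuation at least `-1 - v(l)`, and at least `-v(l)` if `l = m + 1`
(`norm_coeff_powerSumPoly`). Up to the term `(α - 1) l`, which measures the radius of the disks, a step
of index `L` thus gains `L` and loses at most `1 + v(l)`; each letter gains `1`. The degrees `l` met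
along a path are at most `l + S + ΣL`, because every index `L` is at least `-1`. This gives
`valGe_piece`: the valuation of a piece is at least `S + ΣL - d (1 + b) - (α - 1) l`, where `b` is the
integral part of `log_p (l + S + ΣL)`. Beyond the threshold the concavity of the logarithm turns this
into (i) (`le_of_thresholdAt_le`). In (ii), if `ΣL` is below the threshold at `p`, then `p` exceeds all
the degrees, so `b = 0` and every step loses at most `1` altogether; otherwise `e ≥ 0`, and the argument
of (i) gives the better bound `S + e`.

*Values.* For (iii), the coefficients of the expansions of the iterated integrals are constructed
outright (`mulCoeff`, `divFam`), by the same computation summed over all pieces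
(`CoeffBound.sum_ev`, `SeqExpansion.mul`, `SeqExpansion.div`). Two bounds are carried along: polynomial
growth (`FamGrowth`), which gives the convergence and the membership in `LAE^reg`, and the explicit
bound `wordBound`, which is flat as long as no denominator `v(l)` can occur and then has slope at most
`1`, so that the factor `p ^ (-l)` from the radius of convergence absorbs it. This works for
`p ≥ S + d`. Finally the regularization is unique (`IsRegularization.unique`), since functions in
`LAE^reg` are continuous while the functions `f_i` have poles, so that the bound holds for every function
that satisfies the definition of the regularized iterated integral.
-/

namespace RegIter

open Finset

/-! ### Norms of rational numbers and roots of unity -/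

section Norms

theorem norm_sub_le_max' {K : Type*} [SeminormedAddCommGroup K] [IsUltrametricDist K] (x y : K) :
    ‖x - y‖ ≤ max ‖x‖ ‖y‖ := by
  rw [sub_eq_add_neg, ← norm_neg y]
  exact IsUltrametricDist.norm_add_le_max x (-y)

variable (p : ℕ) [hp : Fact p.Prime] {K : Type*} [NormedField K] [NormedAlgebra ℚ_[p] K]

theorem charZero_of_padic (K : Type*) [NormedField K] [NormedAlgebra ℚ_[p] K] : CharZero K :=
  charZero_of_injective_algebraMap (algebraMap ℚ_[p] K).injective

theorem norm_natCast_eq_padic (n : ℕ) : ‖(n : K)‖ = ‖(n : ℚ_[p])‖ := by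
  rw [← norm_algebraMap' K (n : ℚ_[p]), map_natCast]

theorem norm_intCast_le_one (p : ℕ) [Fact p.Prime] {K : Type*} [NormedField K] [NormedAlgebra ℚ_[p] K]
    (n : ℤ) : ‖(n : K)‖ ≤ 1 := by
  rw [← map_intCast (algebraMap ℚ_[p] K), norm_algebraMap' K]
  exact Padic.norm_int_le_one n

theorem norm_natCast_le_one (p : ℕ) [Fact p.Prime] {K : Type*} [NormedField K] [NormedAlgebra ℚ_[p] K]
    (n : ℕ) : ‖(n : K)‖ ≤ 1 := by
  simpa using norm_intCast_le_one p (K := K) n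

theorem norm_natCast_prime : ‖(p : K)‖ = (p : ℝ)⁻¹ := by
  rw [norm_natCast_eq_padic p, Padic.norm_p]

theorem one_lt_prime_real : (1 : ℝ) < p := by exact_mod_cast hp.out.one_lt

theorem norm_natCast_inv {n : ℕ} (hn : n ≠ 0) : ‖(n : K)⁻¹‖ = (p : ℝ) ^ padicValNat p n := by
  have h0 : (n : ℚ_[p]) ≠ 0 := by exact_mod_cast hn
  rw [norm_inv, norm_natCast_eq_padic p, Padic.norm_eq_zpow_neg_valuation h0, zpow_neg, inv_inv,
    Padic.valuation_natCast, zpow_natCast]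

/-- The inverse of a non-zero residue modulo `p ^ α` has norm at most `p ^ (α - 1)`. -/
theorem norm_natCast_inv_le {r α : ℕ} (h0 : r ≠ 0) (hr : r < p ^ α) :
    ‖(r : K)⁻¹‖ ≤ (p : ℝ) ^ (α - 1) := by
  rw [norm_natCast_inv p h0]
  refine pow_le_pow_right₀ (one_lt_prime_real p).le ?_
  have h1 : p ^ padicValNat p r ≤ r := Nat.le_of_dvd (Nat.pos_of_ne_zero h0) pow_padicValNat_dvd
  have := (Nat.pow_lt_pow_iff_right hp.out.one_lt).1 (h1.trans_lt hr)
  omega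

theorem padicValNat_le_of_lt {n k : ℕ} (h : n < p ^ (k + 1)) : padicValNat p n ≤ k := by
  rcases eq_or_ne n 0 with rfl | h0
  · simp
  have h1 : p ^ padicValNat p n ≤ n := Nat.le_of_dvd (Nat.pos_of_ne_zero h0) pow_padicValNat_dvd
  have := (Nat.pow_lt_pow_iff_right hp.out.one_lt).1 (h1.trans_lt h)
  omega

variable [IsUltrametricDist K]

/-- A consequence of the von Staudt–Clausen theorem: `p B_k` is `p`-integral. -/
theorem norm_bernoulli_le (k : ℕ) : ‖((bernoulli k : ℚ) : K)‖ ≤ p := by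
  have hp1 := one_lt_prime_real p
  have := charZero_of_padic p K
  have hinv : ∀ q : ℕ, q.Prime → ‖((q : K))⁻¹‖ ≤ p := by
    intro q hq
    rw [norm_natCast_inv p hq.ne_zero]
    have : padicValNat p q ≤ 1 := by
      by_cases h : p = q
      · subst h; simp
      · have : Fact q.Prime := ⟨hq⟩
        rw [padicValNat_primes h]; omega
    calc (p : ℝ) ^ padicValNat p q ≤ (p : ℝ) ^ 1 := pow_le_pow_right₀ hp1.le this
      _ = p := pow_one _
  rcases Nat.even_or_odd k with ⟨j, hj⟩ | hk
  · obtain ⟨T, hT⟩ := Bernoulli.vonStaudt_clausen j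
    have hB : bernoulli k =
        T - ∑ q ∈ range (2 * j + 2) with q.Prime ∧ (q - 1) ∣ 2 * j, (1 : ℚ) / q := by
      rw [hT, hj, two_mul]; ring
    rw [hB]
    push_cast
    refine (norm_sub_le_max' _ _).trans (max_le ((norm_intCast_le_one p T).trans hp1.le) ?_)
    refine IsUltrametricDist.norm_sum_le_of_forall_le_of_nonneg (by positivity) fun q hq => ?_
    rw [one_div]
    exact hinv q (mem_filter.1 hq).2.1
  · rcases eq_or_ne k 1 with rfl | h1
    · rw [bernoulli_one]
      push_cast
      have := hinv 2 Nat.prime_two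
      rw [neg_div, norm_neg, one_div]
      exact_mod_cast this
    · rw [bernoulli_eq_zero_of_odd hk (by have := hk.pos; omega)]
      simp

theorem norm_root_of_unity {K : Type*} [NormedField K] {N : ℕ} (hN : N ≠ 0) {ζ : K}
    (h : ζ ^ N = 1) : ‖ζ‖ = 1 :=
  (pow_eq_one_iff_of_nonneg (norm_nonneg ζ) hN).1 (by rw [← norm_pow, h, norm_one])

/-- Roots of unity of order prime to `p` stay distinct in the residue field. -/
theorem norm_root_sub_one {N : ℕ} (hN : ¬ p ∣ N) {ζ : K} (h : ζ ^ N = 1) (h1 : ζ ≠ 1) :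
    ‖ζ - 1‖ = 1 := by
  have hN0 : N ≠ 0 := fun h => hN (h ▸ dvd_zero p)
  have hζ : ‖ζ‖ = 1 := norm_root_of_unity hN0 h
  have hsum : ∑ k ∈ range N, ζ ^ k = 0 := by
    have := mul_geom_sum ζ N
    rw [h, sub_self] at this
    exact (mul_eq_zero.1 this).resolve_left (sub_ne_zero.2 h1)
  have hle : ‖ζ - 1‖ ≤ 1 := (norm_sub_le_max' _ _).trans (by simp [hζ])
  refine le_antisymm hle ?_
  have hNn : ‖(N : K)‖ = 1 := by
    rw [norm_natCast_eq_padic p]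
    exact Padic.norm_natCast_eq_one_iff.2 ((Nat.Prime.coprime_iff_not_dvd hp.out).2 hN)
  have hterm : ∀ k, ‖ζ ^ k - 1‖ ≤ ‖ζ - 1‖ := by
    intro k
    rw [← mul_geom_sum, norm_mul]
    refine mul_le_of_le_one_right (norm_nonneg _) ?_
    refine IsUltrametricDist.norm_sum_le_of_forall_le_of_nonneg zero_le_one fun i _ => ?_
    simp [hζ]
  have h2 : ∑ k ∈ range N, (ζ ^ k - 1) = -(N : K) := by
    rw [sum_sub_distrib, hsum]; simp
  rw [← hNn, ← norm_neg, ← h2]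
  exact IsUltrametricDist.norm_sum_le_of_forall_le_of_nonneg (norm_nonneg _) fun k _ => hterm k

end Norms

/-! ### Coefficients of the power sum polynomials -/

section PowerSumCoefficients

open Polynomial

/-- The difference equation behind the summation formula of `IsPowerSumPoly`. -/
theorem IsPowerSumPoly.difference {K : Type*} [Field K] [CharZero K] {ζ : K} (hζ : ζ ≠ 0) {m : ℕ}
    {P : K[X]} (h : IsPowerSumPoly ζ m P) : C ζ * P.comp (X + 1) - P = X ^ m := by
  refine eq_of_infinite_eval_eq _ _ ((Set.infinite_range_of_injective
    (Nat.cast_injective (R := K))).mono ?_)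
  rintro _ ⟨u, rfl⟩
  have h1 := h.2 (u + 1)
  rw [sum_range_succ, h.2 u] at h1
  have hu : ζ ^ u ≠ 0 := pow_ne_zero _ hζ
  simp only [Set.mem_ofPred_eq, eval_sub, eval_mul, eval_C, eval_comp, eval_add, eval_X, eval_one,
    eval_pow]
  push_cast at h1
  refine mul_left_cancel₀ hu ?_
  linear_combination -h1

/-- For `ζ ≠ 1` the operator `P ↦ ζ P(X + 1) - P(X)` is injective. -/
theorem eq_of_twisted_difference_eq {K : Type*} [Field K] {ζ : K} (h1 : ζ ≠ 1) {P Q : K[X]}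
    (h : C ζ * P.comp (X + 1) - P = C ζ * Q.comp (X + 1) - Q) : P = Q := by
  by_contra hne
  have h2 : C ζ * (P - Q).comp (X + 1) = P - Q := by
    rw [sub_comp]; linear_combination h
  have h3 := congrArg leadingCoeff h2
  have hm : (X + 1 : K[X]).Monic := by simpa using monic_X_add_C (1 : K)
  have hd : (X + 1 : K[X]).natDegree ≠ 0 := by
    have := natDegree_X_add_C (1 : K)
    rw [C_1] at this
    omega
  have hl : ((P - Q).comp (X + 1)).leadingCoeff = (P - Q).leadingCoeff := by
    rw [leadingCoeff_comp hd, hm.leadingCoeff, one_pow, mul_one]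
  rw [leadingCoeff_mul, leadingCoeff_C, hl] at h3
  have h4 : (P - Q).leadingCoeff ≠ 0 := leadingCoeff_ne_zero.2 (sub_ne_zero.2 hne)
  exact h1 (mul_right_cancel₀ h4 (h3.trans (one_mul _).symm))

/-- Faulhaber's formula for the coefficients of `powerSumPoly 1 m`. -/
theorem powerSumPoly_one_coeff {K : Type*} [Field K] [CharZero K] (m l : ℕ) :
    (powerSumPoly (1 : K) m).coeff l =
      if 1 ≤ l ∧ l ≤ m + 1 then
        ((_root_.bernoulli (m + 1 - l) : ℚ) : K) * (m.choose (l - 1) : K) * (l : K)⁻¹ else 0 := by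
  set F : K[X] := ∑ i ∈ range (m + 1),
    C (((_root_.bernoulli i * ((m + 1).choose i) / (m + 1) : ℚ)) : K) * X ^ (m + 1 - i) with hF
  have hP : powerSumPoly (1 : K) m = F := by
    refine eq_of_infinite_eval_eq _ _ ((Set.infinite_range_of_injective
      (Nat.cast_injective (R := K))).mono ?_)
    rintro _ ⟨u, rfl⟩
    have h := isPowerSumPoly_powerSumPoly (1 : K) m
    have h1 := h.2 u
    rw [h.1 rfl] at h1
    simp only [one_pow, one_mul, sub_zero] at h1
    rw [Set.mem_ofPred_eq, ← h1]
    have h2 := congrArg (Rat.cast : ℚ → K) (sum_range_pow u m)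
    push_cast at h2
    rw [h2, hF, eval_finsetSum]
    refine sum_congr rfl fun i _ => ?_
    simp only [eval_mul, eval_C, eval_pow, eval_X]
    push_cast
    ring
  rw [hP, hF, finsetSum_coeff]
  simp only [coeff_C_mul_X_pow]
  split_ifs with hl
  · rw [sum_eq_single (m + 1 - l)]
    · rw [if_pos (by omega)]
      have h1 : (m + 1).choose (m + 1 - l) = (m + 1).choose l := Nat.choose_symm hl.2
      have h2 : (m + 1) * m.choose (l - 1) = (m + 1).choose l * l := by
        have := Nat.add_one_mul_choose_eq m (l - 1)
        rwa [Nat.sub_add_cancel hl.1] at this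
      have h3 : ((m : K) + 1) * (m.choose (l - 1) : K) = ((m + 1).choose l : K) * l := by
        exact_mod_cast h2
      have hl0 : (l : K) ≠ 0 := by exact_mod_cast (by omega : l ≠ 0)
      have hm0 : (m : K) + 1 ≠ 0 := by exact_mod_cast Nat.succ_ne_zero m
      push_cast
      rw [h1]
      field_simp
      linear_combination -(_root_.bernoulli (m + 1 - l) : K) * h3
    · intro i hi hne
      rw [if_neg]
      have := mem_range.1 hi
      omega
    · intro h
      exact absurd (mem_range.2 (by omega)) h
  · refine sum_eq_zero fun i hi => if_neg ?_
    have := mem_range.1 hi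
    omega

variable (p : ℕ) [hp : Fact p.Prime] {K : Type*} [NormedField K] [NormedAlgebra ℚ_[p] K]
  [IsUltrametricDist K]

/-- For `ζ ≠ 1` with `ζ - 1` a unit, the power sum polynomials are integral of degree at most `m`. -/
theorem norm_coeff_powerSumPoly_of_ne_one (p : ℕ) [Fact p.Prime] {K : Type*} [NormedField K] [NormedAlgebra ℚ_[p] K]
    [IsUltrametricDist K] {ζ : K} (h0 : ‖ζ‖ = 1) (h1 : ‖ζ - 1‖ = 1) (m : ℕ) :
    (∀ l, ‖(powerSumPoly ζ m).coeff l‖ ≤ 1) ∧ ∀ l, m < l → (powerSumPoly ζ m).coeff l = 0 := by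
  have := charZero_of_padic p K
  have hζ0 : ζ ≠ 0 := by rintro rfl; simp at h0
  have hζ1 : ζ ≠ 1 := by rintro rfl; simp at h1
  have hs : ζ - 1 ≠ 0 := sub_ne_zero.2 hζ1
  induction m using Nat.strong_induction_on with
  | _ m ih =>
    set Q : K[X] := C (ζ - 1)⁻¹ * (X ^ m - C ζ *
      ∑ j ∈ range m, C ((m.choose j : ℕ) : K) * powerSumPoly ζ j) with hQ
    have hPQ : powerSumPoly ζ m = Q := by
      refine eq_of_twisted_difference_eq hζ1 ?_
      rw [(isPowerSumPoly_powerSumPoly ζ m).difference hζ0]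
      have hj : ∀ j, C ζ * (powerSumPoly ζ j).comp (X + 1) = powerSumPoly ζ j + X ^ j := fun j => by
        rw [← (isPowerSumPoly_powerSumPoly ζ j).difference hζ0]; ring
      have hX : (X + 1 : K[X]) ^ m = ∑ j ∈ range m, C ((m.choose j : ℕ) : K) * X ^ j + X ^ m := by
        rw [add_pow, sum_range_succ]
        simp [mul_comm]
      have hsum : C ζ * ∑ j ∈ range m, C ((m.choose j : ℕ) : K) * (powerSumPoly ζ j).comp (X + 1) =
          ∑ j ∈ range m, C ((m.choose j : ℕ) : K) * powerSumPoly ζ j +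
          ∑ j ∈ range m, C ((m.choose j : ℕ) : K) * X ^ j := by
        rw [mul_sum, ← sum_add_distrib]
        refine sum_congr rfl fun j _ => ?_
        rw [mul_left_comm, hj]; ring
      have hc : C (ζ - 1)⁻¹ * (C ζ - 1) = (1 : K[X]) := by
        rw [← C_1, ← C_sub, ← C_mul, inv_mul_cancel₀ hs]
      simp only [hQ, mul_comp, sub_comp, C_comp, pow_comp, X_comp, Polynomial.sum_comp]
      rw [hX]
      linear_combination (-(X : K[X]) ^ m) * hc + C ζ * C (ζ - 1)⁻¹ * hsum
    rw [hPQ]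
    have hco : ∀ l, Q.coeff l = (ζ - 1)⁻¹ * ((X ^ m : K[X]).coeff l - ζ *
        ∑ j ∈ range m, ((m.choose j : ℕ) : K) * (powerSumPoly ζ j).coeff l) := fun l => by
      rw [hQ, coeff_C_mul, coeff_sub, coeff_C_mul, finsetSum_coeff]
      simp only [coeff_C_mul]
    refine ⟨fun l => ?_, fun l hl => ?_⟩
    · rw [hco, norm_mul, norm_inv, h1, inv_one, one_mul]
      refine (norm_sub_le_max' _ _).trans (max_le ?_ ?_)
      · rw [coeff_X_pow]; split_ifs <;> simp
      · rw [norm_mul, h0, one_mul]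
        refine IsUltrametricDist.norm_sum_le_of_forall_le_of_nonneg zero_le_one fun j hj => ?_
        rw [norm_mul]
        exact mul_le_one₀ (norm_natCast_le_one p _) (norm_nonneg _) ((ih j (mem_range.1 hj)).1 l)
    · rw [hco, coeff_X_pow, if_neg hl.ne', sum_eq_zero, mul_zero, sub_zero, mul_zero]
      intro j hj
      rw [(ih j (mem_range.1 hj)).2 l ((mem_range.1 hj).trans hl), mul_zero]

/-- The exponent of `p` allowed in the denominator of the `l`-th coefficient of `powerSumPoly ζ m`:
the Bernoulli number costs `1`, except in the leading term, and the division by `l` costs its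
valuation. -/
def denomExp (l m : ℕ) : ℕ := padicValNat p l + if l ≤ m then 1 else 0

/-- The denominators of the power sum polynomials: for `ζ = 1` this rests on Faulhaber's formula and the
von Staudt–Clausen theorem, and for `ζ ≠ 1` the coefficients are integral. -/
theorem norm_coeff_powerSumPoly {N : ℕ} (hN : ¬ p ∣ N) {ζ : K} (hζ : ζ ^ N = 1) (l m : ℕ) :
    ‖(powerSumPoly ζ m).coeff l‖ ≤ (p : ℝ) ^ denomExp p l m := by
  have hp1 := one_lt_prime_real p
  have hN0 : N ≠ 0 := fun h => hN (h ▸ dvd_zero p)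
  have := charZero_of_padic p K
  by_cases h1 : ζ = 1
  · subst h1
    rw [powerSumPoly_one_coeff]
    split_ifs with hl
    · rw [norm_mul, norm_mul, norm_natCast_inv p (by omega : l ≠ 0), denomExp,
        add_comm (padicValNat p l), pow_add]
      refine mul_le_mul_of_nonneg_right ?_ (by positivity)
      refine (mul_le_of_le_one_right (norm_nonneg _) (norm_natCast_le_one p _)).trans ?_
      split_ifs with hm
      · simpa using norm_bernoulli_le p (m + 1 - l)
      · rw [show m + 1 - l = 0 by omega]
        simp
    · simp only [norm_zero]; positivity
  · exact ((norm_coeff_powerSumPoly_of_ne_one p (norm_root_of_unity hN0 hζ)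
      (norm_root_sub_one p hN hζ h1) m).1 l).trans (one_le_pow₀ hp1.le)

theorem coeff_powerSumPoly_eq_zero {N : ℕ} (hN : ¬ p ∣ N) {ζ : K} (hζ : ζ ^ N = 1) {l m : ℕ}
    (hl : m + 1 < l) : (powerSumPoly ζ m).coeff l = 0 := by
  have hN0 : N ≠ 0 := fun h => hN (h ▸ dvd_zero p)
  have := charZero_of_padic p K
  by_cases h1 : ζ = 1
  · subst h1
    rw [powerSumPoly_one_coeff, if_neg (by omega)]
  · exact (norm_coeff_powerSumPoly_of_ne_one p (norm_root_of_unity hN0 hζ)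
      (norm_root_sub_one p hN hζ h1) m).2 l (by omega)

theorem norm_eval_zero_powerSumPoly {N : ℕ} (hN : ¬ p ∣ N) {ζ : K} (hζ : ζ ^ N = 1) (m : ℕ) :
    ‖(powerSumPoly ζ m).eval 0‖ ≤ 1 := by
  have hN0 : N ≠ 0 := fun h => hN (h ▸ dvd_zero p)
  have := charZero_of_padic p K
  by_cases h1 : ζ = 1
  · rw [(isPowerSumPoly_powerSumPoly ζ m).1 h1]; simp
  · rw [← coeff_zero_eq_eval_zero]
    exact (norm_coeff_powerSumPoly_of_ne_one p (norm_root_of_unity hN0 hζ)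
      (norm_root_sub_one p hN hζ h1) m).1 0

end PowerSumCoefficients

/-! ### Valuations of the pieces -/

section PieceBounds

variable (p : ℕ) [hp : Fact p.Prime] {K : Type*} [NormedField K]

/-- The valuation of `x`, normalized by `v(p) = 1`, is at least `a`. -/
def ValGe (a : ℤ) (x : K) : Prop := ‖x‖ ≤ (p : ℝ) ^ (-a)

variable {p}

theorem ValGe.mono {a b : ℤ} {x : K} (h : ValGe p a x) (hab : b ≤ a) : ValGe p b x :=
  h.trans (zpow_le_zpow_right₀ (one_lt_prime_real p).le (by omega))

theorem ValGe.mul {a b : ℤ} {x y : K} (hx : ValGe p a x) (hy : ValGe p b y) :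
    ValGe p (a + b) (x * y) := by
  have hp0 : (p : ℝ) ≠ 0 := (one_pos.trans (one_lt_prime_real p)).ne'
  unfold ValGe at *
  rw [neg_add, zpow_add₀ hp0, norm_mul]
  exact mul_le_mul hx hy (norm_nonneg _) (by positivity)

omit hp in
theorem ValGe.neg {a : ℤ} {x : K} (hx : ValGe p a x) : ValGe p a (-x) := by
  unfold ValGe; rwa [norm_neg]

omit hp in
theorem valGe_zero (a : ℤ) : ValGe p a (0 : K) := by
  unfold ValGe; rw [norm_zero]; positivity

omit hp in
theorem valGe_of_norm_le_one {x : K} (hx : ‖x‖ ≤ 1) : ValGe p 0 x := by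
  unfold ValGe; simpa using hx

variable [IsUltrametricDist K]

omit hp in
theorem ValGe.add {a : ℤ} {x y : K} (hx : ValGe p a x) (hy : ValGe p a y) : ValGe p a (x + y) :=
  (IsUltrametricDist.norm_add_le_max x y).trans (max_le hx hy)

omit hp in
theorem ValGe.sum {ι : Type*} {s : Finset ι} {f : ι → K} {a : ℤ} (h : ∀ i ∈ s, ValGe p a (f i)) :
    ValGe p a (∑ i ∈ s, f i) :=
  IsUltrametricDist.norm_sum_le_of_forall_le_of_nonneg (by positivity) h

variable [NormedAlgebra ℚ_[p] K]

omit [IsUltrametricDist K] in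
theorem valGe_prime_pow_zpow (α : ℕ) (L : ℤ) : ValGe p (α * L) (((p : K) ^ α) ^ L) := by
  unfold ValGe
  rw [norm_zpow, norm_pow, norm_natCast_prime p, ← zpow_natCast, ← zpow_mul, inv_zpow, zpow_neg]

omit [IsUltrametricDist K] in
theorem valGe_prime_pow_pow (α s : ℕ) : ValGe p (α * s) (((p : K) ^ α) ^ s) := by
  simpa using valGe_prime_pow_zpow (K := K) (p := p) α (s : ℤ)

omit [IsUltrametricDist K] in
theorem valGe_inv_pow {r α : ℕ} (hα : 1 ≤ α) (h0 : r ≠ 0) (hr : r < p ^ α) (k : ℕ) :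
    ValGe p (-(((α : ℤ) - 1) * k)) ((r : K) ^ k)⁻¹ := by
  unfold ValGe
  rw [neg_neg, ← inv_pow, norm_pow, zpow_mul, zpow_natCast]
  refine pow_le_pow_left₀ (norm_nonneg _) ((norm_natCast_inv_le p h0 hr).trans_eq ?_) k
  rw [← zpow_natCast]
  congr 1
  omega

variable {N : ℕ} {ξ : K}

omit [IsUltrametricDist K] [NormedAlgebra ℚ_[p] K] hp in
theorem norm_root_zpow (hN : ¬ p ∣ N) (hξ : ξ ^ N = 1) (a : ℤ) : ‖ξ ^ a‖ = 1 := by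
  have hN0 : N ≠ 0 := fun h => hN (h ▸ dvd_zero p)
  rw [norm_zpow, norm_root_of_unity hN0 hξ, one_zpow]

omit [IsUltrametricDist K] [NormedAlgebra ℚ_[p] K] in
theorem root_zpow_pow (hξ : ξ ^ N = 1) (a : ℤ) : (ξ ^ a) ^ N = 1 := by
  rw [← zpow_natCast, ← zpow_mul, mul_comm, zpow_mul, zpow_natCast, hξ, one_zpow]

theorem valGe_rangeSum_coeff (hN : ¬ p ∣ N) {ζ : K} (hζ : ζ ^ N = 1) (ρ : SumRange) (l m : ℕ) :
    ValGe p (-(denomExp p l m : ℤ)) ((rangeSum ρ ζ m).1.coeff l) := by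
  have h1 : ValGe p (-(denomExp p l m : ℤ)) ((powerSumPoly ζ m).coeff l) := by
    unfold ValGe
    rw [neg_neg, zpow_natCast]
    exact norm_coeff_powerSumPoly p hN hζ l m
  cases ρ
  · exact h1
  · rw [rangeSum, Polynomial.coeff_add]
    refine h1.add ?_
    refine (valGe_of_norm_le_one ?_).mono (by omega)
    rw [Polynomial.coeff_X_pow]
    split_ifs <;> simp
  · exact h1

theorem valGe_rangeSum_const (hN : ¬ p ∣ N) {ζ : K} (hζ : ζ ^ N = 1) (ρ : SumRange) (m : ℕ) :
    ValGe p 0 (rangeSum ρ ζ m).2 := by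
  have h1 := (valGe_of_norm_le_one (p := p) (norm_eval_zero_powerSumPoly p hN hζ m)).neg
  have h2 : ValGe p 0 (-(0 : K) ^ m) := by
    refine (valGe_of_norm_le_one ?_).neg
    rcases eq_or_ne m 0 with rfl | h <;> simp [*]
  cases ρ
  · simpa only [rangeSum, sub_eq_add_neg] using h1.add h2
  · simpa only [rangeSum, sub_eq_add_neg] using h1.add h2
  · exact h1

/-- The bound also covers the constants `q`, which are integral. -/
theorem valGe_kernel (hN : ¬ p ∣ N) (hξ : ξ ^ N = 1) (α : ℕ) (ρ : SumRange) (i₀ : Fin N) (r₀ : ℕ)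
    (i j : Fin N) (l m : ℕ) :
    ValGe p (-(denomExp p l m : ℤ)) (kernel p α ξ ρ i₀ r₀ i j l m) := by
  have hζ := root_zpow_pow hξ (((i₀ : ℤ) - (j : ℤ)) * (p : ℤ) ^ α)
  refine ValGe.add ?_ ?_
  · split_ifs
    · simpa using (valGe_of_norm_le_one (norm_root_zpow hN hξ _).le).mul
        (valGe_rangeSum_coeff hN hζ ρ l m)
    · exact valGe_zero _
  · split_ifs
    · exact (valGe_rangeSum_const hN hζ ρ m).mono (by omega)
    · exact valGe_zero _

/-- A lower bound `V k t` for the valuation of the pieces of depth `k + 1` and sum of indices `t`,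
up to the weight and the radius of the disks, is preserved by a step if it satisfies these
inequalities, where `b` bounds the valuation of the degrees at which polynomials are expanded. -/
structure StepBound (b : ℕ) (V : ℕ → ℤ → ℤ) : Prop where
  zero : V 0 0 ≤ 0
  carry : ∀ k t, V (k + 1) t ≤ V k t
  shift : ∀ k t, V (k + 1) t ≤ V k (t + 1) - 1 - b
  gain : ∀ k t (L : ℕ), V (k + 1) t ≤ V k (t - L) + L - 1 - b

theorem valGe_step (hN : ¬ p ∣ N) (hξ : ξ ^ N = 1) {α : ℕ} {b : ℕ} {V : ℕ → ℤ → ℤ}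
    (hV : StepBound b V) (a : Arrow) (len : ℕ) {T : ℤ → ℕ → Fin N → ℕ → K} {i₀ : Fin N} {t : ℤ}
    {r₀ : ℕ} (hr₀ : r₀ < p ^ α) (i : Fin N) {l : ℕ} {S : ℤ} {k : ℕ} (hl : padicValNat p l ≤ b)
    (hT : ∀ (t' : ℤ) (r : ℕ) (j : Fin N) (m : ℕ), r < p ^ α → (m : ℤ) + t' = l + t →
      ValGe p (S + V k t' - ((α : ℤ) - 1) * m) (T t' r j m)) :
    ValGe p (S + V (k + 1) t - ((α : ℤ) - 1) * l) (step p α ξ a len T i₀ t r₀ i l) := by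
  have hpos : 0 < p ^ α := pow_pos hp.out.pos _
  have key : ∀ m, l - 1 ≤ m → ∀ r < p ^ α, ∀ ρ j,
      ValGe p (S + V (k + 1) t - ((α : ℤ) - 1) * l - α * ((m : ℤ) - l))
        (kernel p α ξ ρ i₀ r₀ i j l m * T (t - ((m : ℤ) - l)) r j m) := by
    intro m hm r hr ρ j
    refine ((valGe_kernel hN hξ α ρ i₀ r₀ i j l m).mul (hT _ r j m hr (by ring))).mono ?_
    unfold denomExp
    rcases Nat.lt_or_ge m l with h | h
    · have hml : (m : ℤ) = l - 1 := by omega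
      have := hV.shift k t
      rw [if_neg (by omega), hml, show t - ((l : ℤ) - 1 - l) = t + 1 by ring]
      push_cast
      linarith [(Nat.cast_le (α := ℤ)).2 hl]
    · have := hV.gain k t (m - l)
      push_cast [h] at this
      rw [if_pos h]
      push_cast
      linarith [(Nat.cast_le (α := ℤ)).2 hl]
  cases a
  · refine (ValGe.sum fun m hm => ?_).neg
    have hm' := (mem_Icc.1 hm).1
    refine ((valGe_prime_pow_zpow α ((m : ℤ) - l)).mul (ValGe.sum
      (a := S + V (k + 1) t - ((α : ℤ) - 1) * l - α * ((m : ℤ) - l))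
      fun j _ => key m hm' 0 hpos _ j)).mono (by linarith)
  · refine (ValGe.sum fun m hm => ?_).neg
    have hm' := (mem_Icc.1 hm).1
    refine ((valGe_prime_pow_zpow α ((m : ℤ) - l)).mul (ValGe.sum
      (a := S + V (k + 1) t - ((α : ℤ) - 1) * l - α * ((m : ℤ) - l))
      fun r hr => ValGe.sum fun j _ => ?_)).mono (by linarith)
    rw [mul_assoc]
    exact ((valGe_of_norm_le_one (norm_root_zpow hN hξ _).le).mul
        (key m hm' r (mem_Ico.1 hr).2 _ j)).mono (by linarith)
  · refine (ValGe.sum fun r hr => ?_).neg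
    have hr' : r < p ^ α := (mem_Ico.1 hr).2.trans hr₀
    have := (valGe_of_norm_le_one (norm_root_zpow hN hξ
      (((i : ℤ) - (i₀ : ℤ)) * ((r₀ : ℤ) - (r : ℤ)))).le).mul (hT t r i l hr' rfl)
    exact this.mono (by linarith [hV.carry k t])

omit [IsUltrametricDist K] [NormedAlgebra ℚ_[p] K] hp in
theorem step_eq_zero (α : ℕ) (a : Arrow) (len : ℕ) {T : ℤ → ℕ → Fin N → ℕ → K} {i₀ : Fin N}
    {t : ℤ} (r₀ : ℕ) (i : Fin N) (l : ℕ) {k : ℕ}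
    (hT : ∀ (t' : ℤ) (r : ℕ) (j : Fin N) (m : ℕ), t' < -(k : ℤ) → T t' r j m = 0)
    (ht : t < -(k : ℤ) - 1) : step p α ξ a len T i₀ t r₀ i l = 0 := by
  cases a
  · refine neg_eq_zero.2 (sum_eq_zero fun m hm => ?_)
    have hm' := (mem_Icc.1 hm).1
    rw [sum_eq_zero, mul_zero]
    intro j _
    rw [hT _ _ _ _ (by omega), mul_zero]
  · refine neg_eq_zero.2 (sum_eq_zero fun m hm => ?_)
    have hm' := (mem_Icc.1 hm).1
    rw [sum_eq_zero, mul_zero]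
    refine fun r _ => sum_eq_zero fun j _ => ?_
    rw [hT _ _ _ _ (by omega), mul_zero]
  · refine neg_eq_zero.2 (sum_eq_zero fun r _ => ?_)
    rw [hT _ _ _ _ (by omega), mul_zero]

omit [IsUltrametricDist K] [NormedAlgebra ℚ_[p] K] hp in
/-- Every index `L` is at least `-1`, so the sum of the indices is at least minus their number. -/
theorem piece_eq_zero (α : ℕ) (w : Blocks N) (γ : List Arrow) :
    ∀ (t : ℤ) (r : ℕ) (i : Fin N) (l : ℕ), t < -(γ.length : ℤ) → piece p α ξ w γ t r i l = 0 := by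
  induction w generalizing γ with
  | nil => intros; simp [piece]
  | cons x w ih =>
    obtain ⟨s, i₀⟩ := x
    intro t r i l ht
    match w, γ with
    | [], [] =>
      rw [piece, if_neg]
      rintro ⟨rfl, -⟩
      simp at ht
    | [], _ :: _ => simp [piece]
    | _ :: _, [] => simp [piece]
    | b :: w, a :: γ =>
      have h0 : ∀ l, step p α ξ a γ.length (piece p α ξ (b :: w) γ) i₀ t r i l = 0 := fun l =>
        step_eq_zero α a _ r i l (ih γ) (by simpa [sub_eq_add_neg, add_comm] using ht)
      rw [piece]
      split_ifs with hr
      · rw [← hr, h0, mul_zero]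
      · simp [h0]

omit [IsUltrametricDist K] in
theorem Blocks.length_le_weight (w : Blocks N) : w.length ≤ w.weight := by
  induction w with
  | nil => simp
  | cons x w ih =>
    have := x.1.pos
    simp only [Blocks.weight, List.map_cons, List.sum_cons, List.length_cons] at *
    omega

/-- The valuation of the pieces, for any bound that is compatible with the steps. The degrees at which
power sum polynomials are expanded are at most `l + w.weight + t`, since the remaining indices `L` and
the remaining blocks contribute at least `-γ.length` and `γ.length`. -/
theorem valGe_piece (hN : ¬ p ∣ N) (hξ : ξ ^ N = 1) {α : ℕ} (hα : 1 ≤ α) {b : ℕ} {V : ℕ → ℤ → ℤ}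
    (hV : StepBound b V) (w : Blocks N) (γ : List Arrow) :
    ∀ (t : ℤ) (r : ℕ) (i : Fin N) (l : ℕ), r < p ^ α → w.length = γ.length + 1 →
      (l : ℤ) + w.weight + t < (p : ℤ) ^ (b + 1) →
      ValGe p (w.weight + V γ.length t - ((α : ℤ) - 1) * l) (piece p α ξ w γ t r i l) := by
  induction w generalizing γ with
  | nil => intro _ _ _ _ _ h; simp at h
  | cons x w ih =>
    obtain ⟨s, i₀⟩ := x
    intro t r i l hr hlen hM
    rcases lt_or_ge t (-(γ.length : ℤ)) with ht | ht
    · rw [piece_eq_zero α _ γ t r i l ht]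
      exact valGe_zero _
    have hweight : Blocks.weight ((s, i₀) :: w) = s + Blocks.weight w := by simp [Blocks.weight]
    rw [hweight] at hM ⊢
    push_cast at hM ⊢
    match w, γ with
    | [], [] =>
      rw [piece]
      split_ifs with h
      · obtain ⟨rfl, h0, rfl⟩ := h
        refine (((valGe_prime_pow_pow α s).neg.mul (valGe_of_norm_le_one
          (norm_intCast_le_one p _))).mul (valGe_inv_pow hα h0 hr _)).mono ?_
        have := hV.zero
        simp [Blocks.weight]
        linarith
      · exact valGe_zero _
    | [], _ :: _ => simp at hlen
    | _ :: _, [] => simp at hlen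
    | c :: w, a :: γ =>
      have hlen' : (c :: w).length = γ.length + 1 := by simpa using hlen
      have hwl := Blocks.length_le_weight (c :: w)
      have hlg : ((a :: γ).length : ℤ) = γ.length + 1 := by simp
      rw [hlg] at ht
      set S' := Blocks.weight (c :: w) with hS'
      have hstep : ∀ l₁ : ℕ, l₁ ≤ l + s → (l₁ : ℤ) ≤ l + s →
          ValGe p ((S' : ℤ) + V (γ.length + 1) t - ((α : ℤ) - 1) * l₁)
            (step p α ξ a γ.length (piece p α ξ (c :: w) γ) i₀ t r i l₁) := by
        intro l₁ hl₁ hl₁'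
        refine valGe_step hN hξ hV a γ.length hr i ?_ fun t' r' j m hr' hmt => ?_
        · refine padicValNat_le_of_lt (p := p) ?_
          have : (l₁ : ℤ) < (p : ℤ) ^ (b + 1) := by omega
          exact_mod_cast this
        · exact ih γ t' r' j m hr' hlen' (by omega)
      rw [piece]
      split_ifs with h0
      · subst h0
        refine ((valGe_prime_pow_pow α s).mul (hstep (l + s) le_rfl (by push_cast; rfl))).mono ?_
        rw [List.length_cons]
        push_cast
        linarith
      · refine ((valGe_prime_pow_pow α s).mul (ValGe.sum
          (a := (S' : ℤ) + V (γ.length + 1) t - ((α : ℤ) - 1) * (l + s)) fun l₁ hl₁ => ?_)).mono ?_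
        · have hl : l₁ ≤ l := Nat.lt_succ_iff.1 (mem_range.1 hl₁)
          refine (((valGe_of_norm_le_one (norm_intCast_le_one p _)).mul
            (valGe_inv_pow hα h0 hr _)).mul (hstep l₁ (by omega) (by omega))).mono ?_
          push_cast [hl]
          linarith
        · rw [List.length_cons]
          linarith

end PieceBounds

/-! ### The thresholds -/

section Thresholds

theorem one_lt_kappa_mul_log {p : ℕ} (hp : p.Prime) : 1 < kappa p * Real.log p := by
  unfold kappa
  split_ifs with h
  · subst h
    have := Real.log_two_gt_d9
    push_cast
    linarith
  · have h3 : 3 ≤ p := by have := hp.two_le; omega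
    have : Real.exp 1 < p := Real.exp_one_lt_three.trans_le (by exact_mod_cast h3)
    rw [one_mul]
    exact (Real.lt_log_iff_exp_lt (by exact_mod_cast hp.pos)).2 this

theorem one_le_kappa (p : ℕ) : 1 ≤ kappa p := by
  unfold kappa; split_ifs <;> norm_num

/-- Beyond the threshold, the gain `L` exceeds the loss `d (1 + log_p (l + s + L))` caused by the
denominators of the power sums: this is where the concavity of the logarithm enters. -/
theorem le_of_thresholdAt_le {p : ℕ} (hp : p.Prime) {d s l : ℕ} {e L : ℤ} {M b : ℕ} (hds : d < s)
    (hM : (M : ℤ) = l + s + L) (hb : p ^ b ≤ M) (hL : -(d : ℤ) ≤ L)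
    (h : thresholdAt p d s l e ≤ L) :
    e ≤ s + L - d * (1 + b) ∧ (0 ≤ e → e ≤ L - d * (1 + b)) := by
  have hp1 : (1 : ℝ) < p := by exact_mod_cast hp.one_lt
  have hlog : 0 < Real.log p := Real.log_pos hp1
  have hκ := one_lt_kappa_mul_log hp
  have hκ1 := one_le_kappa p
  set κ := kappa p
  set a : ℝ := l + s + 1 with ha
  have hds' : (d : ℝ) + 1 ≤ s := by exact_mod_cast hds
  have hl0 : (0 : ℝ) ≤ l := Nat.cast_nonneg l
  have hd0 : (0 : ℝ) ≤ d := Nat.cast_nonneg d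
  have ha0 : 0 < a := by positivity
  have hMr : (M : ℝ) = a - 1 + L := by
    have : ((M : ℤ) : ℝ) = ((l + s + L : ℤ) : ℝ) := by rw [hM]
    push_cast at this
    rw [this, ha]; ring
  have hM0 : (0 : ℝ) < M := by
    have : 0 < M := (pow_pos hp.pos b).trans_le hb
    exact_mod_cast this
  have hLd : -(d : ℝ) ≤ L := by exact_mod_cast hL
  have hblog : b * Real.log p ≤ Real.log M := by
    rw [← Real.log_pow]
    exact Real.log_le_log (by positivity) (by exact_mod_cast hb)
  have hpos : 0 < 1 - 1 / (κ * Real.log p) := by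
    rw [sub_pos, div_lt_one (by positivity)]; exact hκ
  have hlog0 : 0 ≤ Real.log (κ * a) := Real.log_nonneg (by nlinarith)
  have h1 : (e : ℝ) + d + d / Real.log p * Real.log (κ * a) ≤
      L * (1 - 1 / (κ * Real.log p)) := (div_le_iff₀ hpos).1 h
  have h1' : (e : ℝ) * Real.log p + d * Real.log p + d * Real.log (κ * a) + L / κ ≤
      L * Real.log p := by
    have h2 := mul_le_mul_of_nonneg_right h1 hlog.le
    have e1 : ((e : ℝ) + d + d / Real.log p * Real.log (κ * a)) * Real.log p =
      e * Real.log p + d * Real.log p + d * Real.log (κ * a) := by field_simp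
    have e2 : L * (1 - 1 / (κ * Real.log p)) * Real.log p = L * Real.log p - L / κ := by
      field_simp
    linarith
  have fin : ∀ x : ℝ, ((e : ℝ) * Real.log p ≤ (x + L - d * (1 + b)) * Real.log p) →
      (e : ℝ) ≤ x + L - d * (1 + b) := fun x hx => le_of_mul_le_mul_right hx hlog
  have hdb : d * (b * Real.log p) ≤ d * Real.log M := mul_le_mul_of_nonneg_left hblog hd0
  rcases le_or_gt 0 (L : ℝ) with hL0 | hL0
  -- For `L ≥ 0`, compare `log M` with the tangent of the logarithm at `κ a`; note that `d ≤ a`.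
  · have h3 : Real.log M ≤ Real.log (κ * a) + (M / (κ * a) - 1) := by
      rw [← sub_le_iff_le_add', ← Real.log_div hM0.ne' (by positivity)]
      exact Real.log_le_sub_one_of_pos (by positivity)
    have h4 : d * (M / (κ * a) - 1) ≤ L / κ := by
      rw [hMr, le_div_iff₀ (by positivity)]
      have : d * ((a - 1 + L) / (κ * a) - 1) * κ = d * (a - 1 + L - κ * a) / a := by field_simp
      rw [this, div_le_iff₀ ha0]
      nlinarith [mul_nonneg hd0 ha0.le]
    have h5 : d * Real.log M ≤ d * Real.log (κ * a) + L / κ := by nlinarith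
    have h6 : (e : ℝ) ≤ 0 + L - d * (1 + b) := fin 0 (by linarith)
    have h7 : e ≤ L - d * (1 + b) := by
      rw [zero_add] at h6; exact_mod_cast h6
    exact ⟨by omega, fun _ => h7⟩
  -- For `L < 0` one has `M < a`, and the weight compensates `L / κ ≥ -d / κ`.
  · have h3 : Real.log M ≤ Real.log (κ * a) := Real.log_le_log hM0 (by nlinarith)
    have h5 : d * Real.log M ≤ d * Real.log (κ * a) := mul_le_mul_of_nonneg_left h3 hd0
    have h6 : -(s * Real.log p) ≤ L / κ := by
      rw [le_div_iff₀ (by positivity)]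
      nlinarith
    have h7 : (e : ℝ) ≤ s + L - d * (1 + b) := fin s (by linarith)
    refine ⟨by exact_mod_cast h7, fun he => ?_⟩
    have : (0 : ℝ) ≤ e := by exact_mod_cast he
    have h8 : 0 ≤ thresholdAt p d s l e := div_nonneg (by positivity) hpos.le
    exact absurd (h8.trans h) (not_le.2 hL0)

end Thresholds

/-! ### The bounds for the pieces in terms of the thresholds -/

section Parts

/-- The general bound, with a loss `1 + b` in each step. -/
theorem stepBound_sub (b : ℕ) : StepBound b fun k t => t - k * (1 + b) where
  zero := by simp
  carry k t := by push_cast; nlinarith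
  shift k t := by push_cast; linarith
  gain k t L := by push_cast; linarith

/-- When no degree is divisible by `p`, an index `L` is never less than `-1` after deduction of the
loss. -/
theorem stepBound_neg : StepBound 0 fun k _ => -k where
  zero := by simp
  carry k t := by push_cast; linarith
  shift k t := by push_cast; linarith
  gain k t L := by push_cast; linarith

theorem norm_piece_le {N : ℕ} {d : ℕ} {w : Blocks N} (hw : w.length = d + 1)
    (p : ℕ) [hp : Fact p.Prime] (hN : ¬ p ∣ N) {α : ℕ} (hα : 1 ≤ α)
    {K : Type*} [NormedField K] [NormedAlgebra ℚ_[p] K] [IsUltrametricDist K]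
    {ξ : K} (hξ : ξ ^ N = 1) {r : ℕ} (hr : r < p ^ α) {γ : List Arrow} (hγ : γ.length = d)
    {L : ℤ} (hL : -(d : ℤ) ≤ L) (e : ℤ) (l : ℕ) (i : Fin N) :
    (thresholdAt p d w.weight l e ≤ L →
      ‖piece p α ξ w γ L r i l‖ ≤ (p : ℝ) ^ (-(e - ((α : ℤ) - 1) * l))) ∧
    ((L < thresholdAt p d w.weight l e ∨ 0 ≤ e ∧ L < threshold d w.weight l e) →
      max (thresholdAt p d w.weight l e + w.weight + l)
        (2 * thresholdAt p d w.weight l e + 3) < p →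
      ‖piece p α ξ w γ L r i l‖ ≤
        (p : ℝ) ^ (-((w.weight : ℤ) - d - ((α : ℤ) - 1) * l))) := by
  have hlen : w.length = γ.length + 1 := by omega
  have hds : d < w.weight := by have := Blocks.length_le_weight w; omega
  obtain ⟨M, hM⟩ : ∃ M : ℕ, (M : ℤ) = l + w.weight + L := ⟨(l + w.weight + L).toNat, by omega⟩
  have hM0 : M ≠ 0 := by omega
  set b := Nat.log p M with hb
  have hb1 : p ^ b ≤ M := Nat.pow_log_le_self p hM0
  have hb2 : M < p ^ (b + 1) := Nat.lt_pow_succ_log_self hp.out.one_lt M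
  have hmain := valGe_piece hN hξ hα (stepBound_sub b) w γ L r i l hr hlen
    (by rw [← hM]; exact_mod_cast hb2)
  rw [hγ] at hmain
  refine ⟨fun h => ?_, fun h hp' => ?_⟩
  · have := (le_of_thresholdAt_le hp.out hds hM hb1 hL h).1
    exact hmain.mono (by linarith)
  · rcases lt_or_ge (L : ℝ) (thresholdAt p d w.weight l e) with h1 | h1
    · have h2 : M < p := by
        have h3 := (le_max_left _ _).trans_lt hp'
        have h4 : ((M : ℤ) : ℝ) = ((l + w.weight + L : ℤ) : ℝ) := by rw [hM]
        push_cast at h4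
        have : (M : ℝ) < p := by linarith
        exact_mod_cast this
      have h5 := valGe_piece hN hξ hα stepBound_neg w γ L r i l hr hlen
        (by rw [← hM, zero_add, pow_one]; exact_mod_cast h2)
      rw [hγ] at h5
      exact h5.mono (by linarith)
    · have he : 0 ≤ e := (h.resolve_left (not_lt.2 h1)).1
      have := (le_of_thresholdAt_le hp.out hds hM hb1 hL h1).2 he
      exact hmain.mono (by linarith)

end Parts

/-! ### Double series and geometric bounds -/

section Swap

/-- Rearrangement of a double series supported on `l ≤ m + 1`. -/
theorem hasSum_swap_of_bound {K : Type*} [NormedField K] [CompleteSpace K] {f : ℕ → ℕ → K}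
    {B : ℕ → ℝ} (hB : Summable fun m : ℕ => ((m : ℝ) + 2) * B m) (hf : ∀ m l, ‖f m l‖ ≤ B m)
    (h0 : ∀ m l, m + 1 < l → f m l = 0) {S : K}
    (hS : HasSum (fun m => ∑ l ∈ range (m + 2), f m l) S) :
    (∀ l, Summable fun m => f m l) ∧ HasSum (fun l => ∑' m, f m l) S := by
  have hrow : ∀ m, ∀ l ∉ range (m + 2), f m l = 0 := fun m l hl =>
    h0 m l (by have := mt mem_range.2 hl; omega)
  have hnorm : Summable fun x : ℕ × ℕ => ‖f x.1 x.2‖ := by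
    refine (summable_prod_of_nonneg fun _ => norm_nonneg _).2 ⟨fun m => ?_, ?_⟩
    · exact summable_of_ne_finset_zero (s := range (m + 2)) fun l hl => by simp [hrow m l hl]
    · refine Summable.of_nonneg_of_le (fun m => tsum_nonneg fun _ => norm_nonneg _) (fun m => ?_) hB
      rw [tsum_eq_sum (s := range (m + 2)) fun l hl => by simp [hrow m l hl]]
      refine (sum_le_card_nsmul _ _ _ fun l _ => hf m l).trans_eq ?_
      rw [card_range, nsmul_eq_mul]
      push_cast
      ring
  have hsum : Summable fun x : ℕ × ℕ => f x.1 x.2 := hnorm.of_norm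
  have hsw : Summable fun x : ℕ × ℕ => f x.2 x.1 := hsum.prod_symm
  refine ⟨fun l => hsw.prod_factor l, ?_⟩
  have h1 : ∑' x : ℕ × ℕ, f x.1 x.2 = S := by
    rw [hsum.tsum_prod, ← hS.tsum_eq]
    exact tsum_congr fun m => tsum_eq_sum (hrow m)
  have h2 : ∑' x : ℕ × ℕ, f x.2 x.1 = S := by
    rw [← h1]
    exact (Equiv.prodComm ℕ ℕ).tsum_eq fun x : ℕ × ℕ => f x.1 x.2
  rw [← h2]
  exact hsw.hasSum.prod_fiberwise fun l => (hsw.prod_factor l).hasSum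

theorem summable_pow_mul_inv_pow {q : ℝ} (hq : 1 < q) (c k : ℕ) :
    Summable fun l : ℕ => ((l : ℝ) + c) ^ k * (q⁻¹) ^ l := by
  have hq0 : (0 : ℝ) < q := by linarith
  have h1 : Summable fun l : ℕ => (((l + 1 : ℕ) : ℝ) ^ k * (q⁻¹) ^ (l + 1)) :=
    (summable_nat_add_iff 1).2 (summable_pow_mul_geometric_of_norm_lt_one (R := ℝ) k
      (by rw [norm_inv, Real.norm_of_nonneg hq0.le]; exact inv_lt_one_of_one_lt₀ hq))
  refine Summable.of_nonneg_of_le (fun l => by positivity) (fun l => ?_)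
    (h1.mul_left (((c : ℝ) + 1) ^ k * q))
  have h2 : ((l : ℝ) + c) ^ k ≤ (((c : ℝ) + 1) * (l + 1)) ^ k := by
    refine pow_le_pow_left₀ (by positivity) ?_ k
    nlinarith [Nat.cast_nonneg (α := ℝ) l, Nat.cast_nonneg (α := ℝ) c,
      mul_nonneg (Nat.cast_nonneg (α := ℝ) l) (Nat.cast_nonneg (α := ℝ) c)]
  have h3 : q * (q⁻¹) ^ (l + 1) = (q⁻¹) ^ l := by
    rw [pow_succ]; field_simp
  calc ((l : ℝ) + c) ^ k * (q⁻¹) ^ l ≤ (((c : ℝ) + 1) * (l + 1)) ^ k * (q⁻¹) ^ l :=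
        mul_le_mul_of_nonneg_right h2 (by positivity)
    _ = _ := by rw [← h3, mul_pow]; push_cast; ring

end Swap

/-! ### Power series on the disks of radius `p ^ (-α)` -/

section OneVariable

variable (p : ℕ) [hp : Fact p.Prime]

/-- The sequences of real numbers that serve as bounds for coefficients, once the radius of the disks
is taken into account. -/
structure Slow (b : ℕ → ℝ) : Prop where
  nonneg : ∀ l, 0 ≤ b l
  mono : Monotone b
  succ_le : ∀ l, b (l + 1) ≤ p * b l

variable {p}

omit hp in
theorem Slow.add_le {b : ℕ → ℝ} (hb : Slow p b) (l x : ℕ) : b (l + x) ≤ p ^ x * b l := by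
  induction x with
  | zero => simp
  | succ x ih =>
    refine (hb.succ_le (l + x)).trans ?_
    rw [pow_succ', mul_assoc]
    exact mul_le_mul_of_nonneg_left ih (Nat.cast_nonneg p)

theorem slow_pow {A : ℝ} (hA : 0 ≤ A) {c k : ℕ} (h : 2 * k ≤ c) :
    Slow p fun l => A * ((l : ℝ) + c) ^ k where
  nonneg l := by positivity
  mono l l' hl := by
    have : (l : ℝ) ≤ l' := by exact_mod_cast hl
    dsimp only
    gcongr
  succ_le l := by
    have hp2 : (2 : ℝ) ≤ p := by exact_mod_cast hp.out.two_le
    set y : ℝ := l + c with hy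
    have hy0 : 0 ≤ y := by positivity
    have hk : 2 * (k : ℝ) ≤ y := by
      have : 2 * (k : ℝ) ≤ c := by exact_mod_cast h
      have := Nat.cast_nonneg (α := ℝ) l
      linarith
    -- Bernoulli's inequality gives `(y / (y + 1)) ^ k ≥ 1 - k / (y + 1) ≥ 1 / 2`.
    have hb : 1 + (k : ℝ) * (-1 / (y + 1)) ≤ (1 + -1 / (y + 1)) ^ k :=
      one_add_mul_le_pow (by rw [le_div_iff₀ (by positivity)]; linarith) k
    have h1 : (1 : ℝ) / 2 ≤ 1 + (k : ℝ) * (-1 / (y + 1)) := by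
      have : (k : ℝ) / (y + 1) ≤ 1 / 2 := by
        rw [div_le_iff₀ (by positivity)]; linarith
      have e : (k : ℝ) * (-1 / (y + 1)) = -(k / (y + 1)) := by ring
      linarith
    have h2 : (1 + -1 / (y + 1)) ^ k = y ^ k / (y + 1) ^ k := by
      rw [← div_pow]; congr 1; field_simp; ring
    have h3 : (y + 1) ^ k ≤ 2 * y ^ k := by
      have := h1.trans hb
      rw [h2, le_div_iff₀ (by positivity)] at this
      linarith
    have h4 : (((l + 1 : ℕ) : ℝ) + c) = y + 1 := by push_cast; ring
    simp only [h4]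
    calc A * (y + 1) ^ k ≤ A * (2 * y ^ k) := mul_le_mul_of_nonneg_left h3 hA
      _ ≤ A * (p * y ^ k) := by gcongr
      _ = _ := by ring

variable (p) (α : ℕ) {K : Type*} [NormedField K]

/-- `‖c_l‖ ≤ b_l p ^ ((α - 1) l)` for all `l`. -/
def CoeffBound (b : ℕ → ℝ) (c : ℕ → K) : Prop := ∀ l, ‖c l‖ ≤ b l * ((p : ℝ) ^ (α - 1)) ^ l

/-- The sum of the power series with coefficients `c`. -/
noncomputable def ev (c : ℕ → K) (x : K) : K := ∑' l, c l * x ^ l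

variable {p α}

theorem pow_mul_inv_pow_eq (hα : 1 ≤ α) : (p : ℝ) ^ (α - 1) * ((p : ℝ) ^ α)⁻¹ = (p : ℝ)⁻¹ := by
  have hp0 : (p : ℝ) ≠ 0 := (one_pos.trans (one_lt_prime_real p)).ne'
  obtain ⟨β, rfl⟩ : ∃ β, α = β + 1 := ⟨α - 1, by omega⟩
  rw [Nat.add_sub_cancel, pow_succ]
  field_simp

omit hp in
theorem CoeffBound.mono {b b' : ℕ → ℝ} {c : ℕ → K} (h : CoeffBound p α b c) (hb : ∀ l, b l ≤ b' l) :
    CoeffBound p α b' c := fun l =>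
  (h l).trans (mul_le_mul_of_nonneg_right (hb l) (by positivity))

/-- The terms decrease like `b_l p ^ (-l)` on the disk of radius `p ^ (-α)`. -/
theorem CoeffBound.norm_term_le (hα : 1 ≤ α) {b : ℕ → ℝ} {c : ℕ → K} (h : CoeffBound p α b c) {x : K}
    (hx : ‖x‖ ≤ ((p : ℝ) ^ α)⁻¹) (l : ℕ) : ‖c l * x ^ l‖ ≤ b l * ((p : ℝ)⁻¹) ^ l := by
  rw [norm_mul, norm_pow, ← pow_mul_inv_pow_eq hα, mul_pow, ← mul_assoc]
  exact mul_le_mul (h l) (pow_le_pow_left₀ (norm_nonneg _) hx l) (by positivity)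
    ((norm_nonneg _).trans (h l))

variable [CompleteSpace K]

theorem CoeffBound.hasSum (hα : 1 ≤ α) {A : ℝ} {m k : ℕ} {c : ℕ → K}
    (h : CoeffBound p α (fun l => A * ((l : ℝ) + m) ^ k) c) {x : K}
    (hx : ‖x‖ ≤ ((p : ℝ) ^ α)⁻¹) : HasSum (fun l => c l * x ^ l) (ev c x) := by
  refine Summable.hasSum (Summable.of_norm_bounded
    (((summable_pow_mul_inv_pow (one_lt_prime_real p) m k).mul_left A)) fun l => ?_)
  rw [← mul_assoc]
  exact h.norm_term_le hα hx l

section Shift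

variable [NormedAlgebra ℚ_[p] K]

omit [CompleteSpace K] in
theorem norm_prime_pow : ‖(p : K) ^ α‖ = ((p : ℝ) ^ α)⁻¹ := by
  rw [norm_pow, norm_natCast_prime, inv_pow]

omit [NormedAlgebra ℚ_[p] K] in
theorem CoeffBound.ev_shift (hα : 1 ≤ α) {A : ℝ} {m k : ℕ} {c : ℕ → K}
    (h : CoeffBound p α (fun l => A * ((l : ℝ) + m) ^ k) c) {x : K}
    (hx : ‖x‖ ≤ ((p : ℝ) ^ α)⁻¹) : x * ev (fun l => c (l + 1)) x = ev c x - c 0 := by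
  have hs := h.hasSum hα hx
  have h1 := (hasSum_nat_add_iff' 1).2 hs
  simp only [range_one, sum_singleton, pow_zero, mul_one] at h1
  rcases eq_or_ne x 0 with rfl | hx0
  · rw [zero_mul]
    refine (h1.unique ?_).symm
    simp [hasSum_zero]
  · have h2 : HasSum (fun l => c (l + 1) * x ^ l) (x⁻¹ * (ev c x - c 0)) := by
      have hfun : (fun l => c (l + 1) * x ^ l) = fun l => x⁻¹ * (c (l + 1) * x ^ (l + 1)) := by
        funext l
        rw [pow_succ]
        field_simp
      rw [hfun]
      exact h1.mul_left x⁻¹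
    rw [ev, h2.tsum_eq, mul_inv_cancel_left₀ hx0]

omit [CompleteSpace K] in
theorem CoeffBound.shift (hα : 1 ≤ α) {b : ℕ → ℝ} {c : ℕ → K} (h : CoeffBound p α b c) :
    CoeffBound p α (fun l => (p : ℝ)⁻¹ * b (l + 1)) fun l => (p : K) ^ α * c (l + 1) := by
  intro l
  rw [norm_mul, norm_prime_pow, ← pow_mul_inv_pow_eq hα]
  refine (mul_le_mul_of_nonneg_left (h (l + 1)) (by positivity)).trans_eq ?_
  ring

end Shift

section Division

/-- The coefficients of `π f / (ρ + x)`, where `f` is the power series with coefficients `c`. -/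
noncomputable def divCoeff {K : Type*} [Field K] (π ρ : K) (c : ℕ → K) : ℕ → K
  | 0 => π * c 0 * ρ⁻¹
  | l + 1 => (π * c (l + 1) - divCoeff π ρ c l) * ρ⁻¹

omit [CompleteSpace K] in
theorem CoeffBound.div [IsUltrametricDist K] (hα : 1 ≤ α) {b : ℕ → ℝ} (hb : Monotone b) {c : ℕ → K}
    (h : CoeffBound p α b c) {π ρ : K} (hπ : ‖π‖ = ((p : ℝ) ^ α)⁻¹)
    (hρ : ‖ρ⁻¹‖ ≤ (p : ℝ) ^ (α - 1)) :
    CoeffBound p α (fun l => (p : ℝ)⁻¹ * b l) (divCoeff π ρ c) := by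
  have h1 : ∀ l, ‖π * c l * ρ⁻¹‖ ≤ (p : ℝ)⁻¹ * b l * ((p : ℝ) ^ (α - 1)) ^ l := by
    intro l
    rw [norm_mul, norm_mul, hπ, ← pow_mul_inv_pow_eq hα]
    refine (mul_le_mul (mul_le_mul_of_nonneg_left (h l) (by positivity)) hρ (norm_nonneg _)
      (mul_nonneg (by positivity) ((norm_nonneg _).trans (h l)))).trans_eq ?_
    ring
  intro l
  induction l with
  | zero => exact h1 0
  | succ l ih =>
    rw [divCoeff, sub_mul]
    refine (norm_sub_le_max' _ _).trans (max_le (h1 _) ?_)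
    rw [norm_mul]
    refine (mul_le_mul ih hρ (norm_nonneg _) ((norm_nonneg _).trans ih)).trans ?_
    rw [pow_succ, ← mul_assoc]
    have hp0 : (0 : ℝ) ≤ (p : ℝ)⁻¹ := by positivity
    exact mul_le_mul_of_nonneg_right (mul_le_mul_of_nonneg_right
      (mul_le_mul_of_nonneg_left (hb l.le_succ) hp0) (by positivity)) (by positivity)

/-- `divCoeff` is defined by the recursion that expresses `(ρ + x) g(x) = π f(x)`. -/
theorem CoeffBound.ev_div [IsUltrametricDist K] (hα : 1 ≤ α) {A : ℝ} (hA : 0 ≤ A) {m k : ℕ} {c : ℕ → K}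
    (h : CoeffBound p α (fun l => A * ((l : ℝ) + m) ^ k) c) {π ρ : K}
    (hπ : ‖π‖ = ((p : ℝ) ^ α)⁻¹) (hρ0 : ρ ≠ 0) (hρ : ‖ρ⁻¹‖ ≤ (p : ℝ) ^ (α - 1)) {x : K}
    (hx : ‖x‖ ≤ ((p : ℝ) ^ α)⁻¹) : (ρ + x) * ev (divCoeff π ρ c) x = π * ev c x := by
  have hmono : Monotone fun l : ℕ => A * ((l : ℝ) + m) ^ k := by
    intro l l' hl
    have : (l : ℝ) ≤ l' := by exact_mod_cast hl
    dsimp only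
    gcongr
  have hd : CoeffBound p α (fun l => (p : ℝ)⁻¹ * A * ((l : ℝ) + m) ^ k) (divCoeff π ρ c) :=
    (h.div hα hmono hπ hρ).mono fun l => (mul_assoc _ _ _).ge
  have h1 := hd.hasSum hα hx
  have h2 := (h.hasSum hα hx).mul_left π
  have h3 := (hasSum_nat_add_iff' 1).2 h2
  have h4 := (((hasSum_nat_add_iff' 1).2 h1).mul_left ρ).add (h1.mul_left x)
  have hfun : (fun l => π * (c (l + 1) * x ^ (l + 1))) = fun l =>
      ρ * (divCoeff π ρ c (l + 1) * x ^ (l + 1)) + x * (divCoeff π ρ c l * x ^ l) := by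
    funext l
    rw [divCoeff, pow_succ]
    field_simp
    ring
  rw [hfun] at h3
  have h5 := h3.unique h4
  simp only [range_one, sum_singleton, pow_zero, mul_one] at h5
  rw [divCoeff] at h5
  have h6 : ρ * (π * c 0 * ρ⁻¹) = π * c 0 := by field_simp
  linear_combination -h5 + h6

end Division

section PowerSum

variable [NormedAlgebra ℚ_[p] K]

variable (p α) in
/-- The coefficients `c'` such that `∑_{k < u} ζ ^ k f(p ^ α k) = ζ ^ u g(p ^ α u) - c' 0`, where `f`
and `g` are the power series with coefficients `c` and `c'`. -/
noncomputable def powSumCoeff (ζ : K) (c : ℕ → K) (l : ℕ) : K :=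
  ∑' m, c m * ((p : K) ^ α) ^ m * (powerSumPoly ζ m).coeff l * (((p : K) ^ α) ^ l)⁻¹

omit hp in
theorem pow_padicValNat_le (l : ℕ) : (p : ℝ) ^ padicValNat p l ≤ l + 1 := by
  rcases eq_or_ne l 0 with rfl | h0
  · simp
  have h1 : p ^ padicValNat p l ≤ l := Nat.le_of_dvd (Nat.pos_of_ne_zero h0) pow_padicValNat_dvd
  have : (p : ℝ) ^ padicValNat p l ≤ l := by exact_mod_cast h1
  linarith

variable [IsUltrametricDist K] {N : ℕ} {ζ : K}

omit [CompleteSpace K] in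
/-- For a slow bound `b`, the term `m = l` dominates the series that defines `powSumCoeff`. -/
theorem CoeffBound.powSum (hN : ¬ p ∣ N) (hζ : ζ ^ N = 1) (hα : 1 ≤ α) {b : ℕ → ℝ} (hb : Slow p b) {c : ℕ → K}
    (h : CoeffBound p α b c) :
    CoeffBound p α (fun l => (p : ℝ) ^ (1 + padicValNat p l) * b l) (powSumCoeff p α ζ c) := by
  intro l
  have hp1 := one_lt_prime_real p
  have hp0 : (0 : ℝ) < p := by linarith
  refine IsUltrametricDist.norm_tsum_le_of_forall_le_of_nonneg
    (mul_nonneg (mul_nonneg (by positivity) (hb.nonneg l)) (by positivity)) fun m => ?_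
  rcases lt_or_ge (m + 1) l with hml | hml
  · rw [coeff_powerSumPoly_eq_zero p hN hζ hml]
    simp only [mul_zero, zero_mul, norm_zero]
    exact mul_nonneg (mul_nonneg (by positivity) (hb.nonneg l)) (by positivity)
  have h1 := h.norm_term_le hα (norm_prime_pow (K := K)).le m
  have h2 := norm_coeff_powerSumPoly p hN hζ l m
  have h3 : ‖(((p : K) ^ α) ^ l)⁻¹‖ = (p : ℝ) ^ l * ((p : ℝ) ^ (α - 1)) ^ l := by
    rw [norm_inv, norm_pow, norm_prime_pow, inv_pow, inv_inv, ← mul_pow, ← pow_succ',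
      Nat.sub_add_cancel hα]
  rw [norm_mul, norm_mul, h3, ← mul_assoc]
  refine mul_le_mul_of_nonneg_right ?_ (by positivity)
  refine (mul_le_mul_of_nonneg_right (mul_le_mul h1 h2 (norm_nonneg _)
    (mul_nonneg (hb.nonneg m) (by positivity))) (by positivity)).trans ?_
  dsimp only
  rw [denomExp, pow_add, pow_add, pow_one]
  have key : b m * (p : ℝ) ^ (if l ≤ m then 1 else 0) * p ^ l ≤ p * b l * p ^ m := by
    split_ifs with hlm
    · obtain ⟨x, rfl⟩ := Nat.exists_eq_add_of_le hlm
      have := mul_le_mul_of_nonneg_right (hb.add_le l x) (by positivity : 0 ≤ (p : ℝ) * p ^ l)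
      rw [pow_add]
      linarith
    · have hl : l = m + 1 := by omega
      have := mul_le_mul_of_nonneg_right (hb.mono (by omega : m ≤ l))
        (by positivity : 0 ≤ (p : ℝ) ^ l)
      rw [hl] at this ⊢
      rw [pow_zero, mul_one]
      refine this.trans_eq ?_
      ring
  have hpm : (p : ℝ)⁻¹ ^ m * p ^ m = 1 := by rw [← mul_pow, inv_mul_cancel₀ hp0.ne', one_pow]
  calc b m * (p : ℝ)⁻¹ ^ m * (p ^ padicValNat p l * p ^ (if l ≤ m then 1 else 0)) * p ^ l
      = (b m * (p : ℝ) ^ (if l ≤ m then 1 else 0) * p ^ l) *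
        ((p : ℝ)⁻¹ ^ m * p ^ padicValNat p l) := by ring
    _ ≤ (p * b l * p ^ m) * ((p : ℝ)⁻¹ ^ m * p ^ padicValNat p l) :=
        mul_le_mul_of_nonneg_right key (by positivity)
    _ = (p : ℝ) * p ^ padicValNat p l * b l * ((p : ℝ)⁻¹ ^ m * p ^ m) := by ring
    _ = _ := by rw [hpm, mul_one]

/-- Twisted sums of the values of a power series: the summation formula of `IsPowerSumPoly` is applied
to each monomial, and the resulting double series is rearranged. -/
theorem CoeffBound.sum_ev (hN : ¬ p ∣ N) (hζ : ζ ^ N = 1) (hα : 1 ≤ α)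
    {A : ℝ} (hA : 0 ≤ A) {n k : ℕ} {c : ℕ → K}
    (h : CoeffBound p α (fun l => A * ((l : ℝ) + n) ^ k) c) (u : ℕ) :
    ∑ t ∈ range u, ζ ^ t * ev c ((p : K) ^ α * t) =
      ζ ^ u * ev (powSumCoeff p α ζ c) ((p : K) ^ α * u) - powSumCoeff p α ζ c 0 := by
  have := charZero_of_padic p K
  have hp1 := one_lt_prime_real p
  have hN0 : N ≠ 0 := fun h => hN (h ▸ dvd_zero p)
  have hζ0 : ζ ≠ 0 := by rintro rfl; rw [zero_pow hN0] at hζ; exact zero_ne_one hζ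
  have hπ0 : (p : K) ^ α ≠ 0 := pow_ne_zero _ (by exact_mod_cast hp.out.ne_zero)
  set π : K := (p : K) ^ α with hπ
  set f : ℕ → ℕ → K → K := fun m l x => c m * π ^ m * (powerSumPoly ζ m).coeff l * x ^ l with hf
  set B : ℕ → ℝ := fun m => A * ((m : ℝ) + n) ^ k * (p : ℝ)⁻¹ ^ m * (p * (m + 2)) with hBdef
  have hB0 : ∀ m, 0 ≤ B m := fun m => by positivity
  have hB : Summable fun m : ℕ => ((m : ℝ) + 2) * B m := by
    refine Summable.of_nonneg_of_le (fun m => by have := hB0 m; positivity) (fun m => ?_)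
      ((summable_pow_mul_inv_pow hp1 (n + 2) (k + 2)).mul_left (A * p))
    have h1 : ((m : ℝ) + n) ^ k ≤ (m + (n + 2 : ℕ)) ^ k :=
      pow_le_pow_left₀ (by positivity) (by push_cast; linarith) k
    have h2 : ((m : ℝ) + 2) ^ 2 ≤ (m + (n + 2 : ℕ)) ^ 2 := by
      refine pow_le_pow_left₀ (by positivity) ?_ 2
      push_cast
      linarith [Nat.cast_nonneg (α := ℝ) n]
    calc ((m : ℝ) + 2) * B m
        = A * p * (((m : ℝ) + n) ^ k * ((m : ℝ) + 2) ^ 2 * (p : ℝ)⁻¹ ^ m) := by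
          rw [hBdef]; ring
      _ ≤ A * p * ((m + (n + 2 : ℕ)) ^ k * (m + (n + 2 : ℕ)) ^ 2 * (p : ℝ)⁻¹ ^ m) := by gcongr
      _ = _ := by ring
  have hfB : ∀ x : K, ‖x‖ ≤ 1 → ∀ m l, ‖f m l x‖ ≤ B m := by
    intro x hx m l
    rcases lt_or_ge (m + 1) l with hml | hml
    · simp only [hf, coeff_powerSumPoly_eq_zero p hN hζ hml, mul_zero, zero_mul, norm_zero]
      exact hB0 m
    have h1 := h.norm_term_le hα (norm_prime_pow (K := K)).le m
    have h2 := norm_coeff_powerSumPoly p hN hζ l m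
    have h3 : (p : ℝ) ^ denomExp p l m ≤ p * (m + 2) := by
      rw [denomExp, pow_add, mul_comm]
      refine mul_le_mul ?_ ?_ (by positivity) (by positivity)
      · split_ifs
        · rw [pow_one]
        · rw [pow_zero]; exact hp1.le
      · refine (pow_padicValNat_le l).trans ?_
        have : (l : ℝ) ≤ m + 1 := by exact_mod_cast hml
        linarith
    rw [hf, norm_mul, norm_mul, norm_pow x]
    refine (mul_le_of_le_one_right (by positivity) (pow_le_one₀ (norm_nonneg _) hx)).trans ?_
    exact mul_le_mul h1 (h2.trans h3) (norm_nonneg _) ((norm_nonneg _).trans h1)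
  have hf0 : ∀ x m l, m + 1 < l → f m l x = 0 := by
    intro x m l hml
    simp only [hf, coeff_powerSumPoly_eq_zero p hN hζ hml, mul_zero, zero_mul]
  have hrow : ∀ x m, ∑ l ∈ range (m + 2), f m l x = c m * π ^ m * (powerSumPoly ζ m).eval x := by
    intro x m
    rw [Polynomial.eval_eq_sum_range' (n := m + 2)]
    · rw [mul_sum]
      exact sum_congr rfl fun l _ => by simp only [hf]; ring
    · refine Nat.lt_of_le_pred (by omega) (Polynomial.natDegree_le_iff_coeff_eq_zero.2 fun l hl => ?_)
      exact coeff_powerSumPoly_eq_zero p hN hζ (by simpa using hl)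
  have hcol : ∀ u : ℕ, ∀ l, ∑' m, f m l (u : K) = powSumCoeff p α ζ c l * (π * u) ^ l := by
    intro u l
    rw [powSumCoeff, ← tsum_mul_right]
    refine tsum_congr fun m => ?_
    simp only [hf, ← hπ, mul_pow]
    field_simp
  have hS0 : Summable fun m => c m * π ^ m * (powerSumPoly ζ m).eval 0 := by
    refine Summable.of_norm_bounded (g := B) ?_ fun m => ?_
    · refine Summable.of_nonneg_of_le hB0 (fun m => ?_) hB
      exact le_mul_of_one_le_left (hB0 m) (by linarith [Nat.cast_nonneg (α := ℝ) m])
    · have := hfB 0 (by simp) m 0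
      simpa only [hf, pow_zero, mul_one, Polynomial.coeff_zero_eq_eval_zero] using this
  have hS0' : HasSum (fun m => c m * π ^ m * (powerSumPoly ζ m).eval 0) (powSumCoeff p α ζ c 0) := by
    convert hS0.hasSum using 1
    rw [powSumCoeff]
    refine tsum_congr fun m => ?_
    rw [pow_zero, inv_one, mul_one, Polynomial.coeff_zero_eq_eval_zero]
  have hx : ∀ t : ℕ, ‖π * (t : K)‖ ≤ ((p : ℝ) ^ α)⁻¹ := fun t => by
    rw [norm_mul, hπ, norm_prime_pow]
    exact mul_le_of_le_one_right (by positivity) (norm_natCast_le_one p t)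
  set S := ∑ t ∈ range u, ζ ^ t * ev c (π * t) with hSdef
  have hS : HasSum (fun m => ∑ t ∈ range u, ζ ^ t * (c m * (π * t) ^ m)) S :=
    hasSum_sum fun t _ => (h.hasSum hα (hx t)).mul_left _
  have hrowsum : HasSum (fun m => ∑ l ∈ range (m + 2), f m l (u : K))
      ((ζ ^ u)⁻¹ * (S + powSumCoeff p α ζ c 0)) := by
    refine Eq.subst (motive := fun g => HasSum g ((ζ ^ u)⁻¹ * (S + powSumCoeff p α ζ c 0)))
      (funext fun m => ?_) ((hS.add hS0').mul_left (ζ ^ u)⁻¹)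
    rw [hrow]
    have h1 := (isPowerSumPoly_powerSumPoly ζ m).2 u
    have h2 : ∑ t ∈ range u, ζ ^ t * (c m * (π * (t : K)) ^ m) =
        c m * π ^ m * ∑ t ∈ range u, ζ ^ t * (t : K) ^ m := by
      rw [mul_sum]
      exact sum_congr rfl fun t _ => by rw [mul_pow]; ring
    rw [h2, h1]
    field_simp
    ring
  have hfin := (hasSum_swap_of_bound hB (hfB u (norm_natCast_le_one p u)) (hf0 u) hrowsum).2
  simp only [hcol u] at hfin
  rw [ev, hfin.tsum_eq]
  field_simp
  ring

end PowerSum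

end OneVariable

/-! ### Expansions of sequences -/

section Families

/-- A sum over `k < q u + r₀`, arranged by the residue of `k` modulo `q`. -/
theorem sum_range_mul_add {M : Type*} [AddCommMonoid M] (f : ℕ → M) (q u r₀ : ℕ) :
    ∑ k ∈ range (q * u + r₀), f k =
      ∑ r ∈ range q, ∑ t ∈ range u, f (q * t + r) + ∑ r ∈ range r₀, f (q * u + r) := by
  rw [sum_range_add, sum_comm]
  congr 1
  induction u with
  | zero => simp
  | succ u ih => rw [mul_add, mul_one, sum_range_add, ih, sum_range_succ]

variable (p : ℕ) [hp : Fact p.Prime] (α : ℕ) {N : ℕ} {K : Type*} [NormedField K]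

/-- The bound `b` holds for all the coefficients of an expansion on the disks of radius `p ^ (-α)`. -/
def FamBound (b : ℕ → ℝ) (C : ℕ → Fin N → ℕ → K) : Prop :=
  ∀ r < p ^ α, ∀ i, CoeffBound p α b (C r i)

/-- Uniform polynomial growth of the coefficients, up to the radius of the disks.  The condition on
the exponent makes the bound `Slow`. -/
def FamGrowth (C : ℕ → Fin N → ℕ → K) : Prop :=
  ∃ (A : ℝ) (m k : ℕ), 0 ≤ A ∧ 2 * k ≤ m ∧ 1 ≤ m ∧ FamBound p α (fun l => A * ((l : ℝ) + m) ^ k) C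

/-- The sequence `h` is given, at the integers `n ≥ n₀`, by the expansions with coefficients `C`. -/
def SeqExpansion (ξ : K) (n₀ : ℕ) (h : ℕ → K) (C : ℕ → Fin N → ℕ → K) : Prop :=
  ∀ r < p ^ α, ∀ u : ℕ, n₀ ≤ p ^ α * u + r →
    h (p ^ α * u + r) =
      ∑ i : Fin N, (ξ ^ (i : ℕ))⁻¹ ^ (p ^ α * u + r) * ev (C r i) ((p : K) ^ α * u)

/-- The coefficients of the expansions of `n ↦ -∑_{0 < k < n} ξ ^ (-i₀ (n - k)) G k`, when `G` has
expansions with coefficients `C`. The term `k = 0` is included in the power sums and compensated by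
`∑ C 0 j' 0`, so that all classes are treated alike. -/
noncomputable def mulCoeff (ξ : K) (i₀ : Fin N) (C : ℕ → Fin N → ℕ → K) (r₀ : ℕ) (j : Fin N) (l : ℕ) :
    K :=
  -(∑ r ∈ range (p ^ α), ξ ^ (((j : ℤ) - i₀) * r₀ + ((i₀ : ℤ) - j) * r) *
      powSumCoeff p α (ξ ^ (((i₀ : ℤ) - j) * (p : ℤ) ^ α)) (C r j) l) -
    ∑ r ∈ range r₀, ξ ^ (((j : ℤ) - i₀) * ((r₀ : ℤ) - r)) * C r j l +
    if l = 0 then if j = i₀ then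
      ∑ r ∈ range (p ^ α), ∑ j' : Fin N, ξ ^ (((i₀ : ℤ) - j') * r) *
        powSumCoeff p α (ξ ^ (((i₀ : ℤ) - j') * (p : ℤ) ^ α)) (C r j') 0 +
      ∑ j' : Fin N, C 0 j' 0 else 0 else 0

/-- The coefficients of the expansions of `n ↦ p ^ α h n / n`, when `h` has expansions with
coefficients `C`; the polar terms at `0` are left out. -/
noncomputable def divFam (C : ℕ → Fin N → ℕ → K) (r : ℕ) (i : Fin N) : ℕ → K :=
  if r = 0 then fun l => (p : K) ^ α * C 0 i (l + 1) else divCoeff ((p : K) ^ α) (r : K) (C r i)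

variable {p α} [NormedAlgebra ℚ_[p] K] [IsUltrametricDist K] {ξ : K}

/-- Multiplication by `z / (z - ξ ^ i₀)` multiplies the bounds by the denominators of the power sums. -/
theorem FamBound.mul (hN : ¬ p ∣ N) (hξ : ξ ^ N = 1) (hα : 1 ≤ α) {b : ℕ → ℝ} (hb : Slow p b)
    {C : ℕ → Fin N → ℕ → K} (h : FamBound p α b C) (i₀ : Fin N) :
    FamBound p α (fun l => (p : ℝ) ^ (1 + padicValNat p l) * b l) (mulCoeff p α ξ i₀ C) := by
  have hp1 := one_lt_prime_real p
  intro r₀ hr₀ j l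
  have hB : ∀ l, 0 ≤ (p : ℝ) ^ (1 + padicValNat p l) * b l * ((p : ℝ) ^ (α - 1)) ^ l := fun l =>
    mul_nonneg (mul_nonneg (by positivity) (hb.nonneg l)) (by positivity)
  have hroot := norm_root_zpow (p := p) hN hξ
  have h1 : ∀ r < p ^ α, ∀ (a : ℤ) (j : Fin N) (l : ℕ),
      ‖ξ ^ a * powSumCoeff p α (ξ ^ (((i₀ : ℤ) - j) * (p : ℤ) ^ α)) (C r j) l‖ ≤
        (p : ℝ) ^ (1 + padicValNat p l) * b l * ((p : ℝ) ^ (α - 1)) ^ l := by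
    intro r hr a j l
    rw [norm_mul, hroot, one_mul]
    exact (h r hr j).powSum hN (root_zpow_pow hξ _) hα hb l
  have h2 : ∀ r < p ^ α, ∀ (j : Fin N) (l : ℕ), ‖C r j l‖ ≤
        (p : ℝ) ^ (1 + padicValNat p l) * b l * ((p : ℝ) ^ (α - 1)) ^ l := by
    intro r hr j l
    refine (h r hr j l).trans (mul_le_mul_of_nonneg_right ?_ (by positivity))
    exact le_mul_of_one_le_left (hb.nonneg l) (one_le_pow₀ hp1.le)
  refine (IsUltrametricDist.norm_add_le_max _ _).trans (max_le ((norm_sub_le_max' _ _).trans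
    (max_le ?_ ?_)) ?_)
  · rw [norm_neg]
    exact IsUltrametricDist.norm_sum_le_of_forall_le_of_nonneg (hB l) fun r hr =>
      h1 r (mem_range.1 hr) _ j l
  · refine IsUltrametricDist.norm_sum_le_of_forall_le_of_nonneg (hB l) fun r hr => ?_
    rw [norm_mul, hroot, one_mul]
    exact h2 r ((mem_range.1 hr).trans hr₀) j l
  · split_ifs with h0
    · subst h0
      refine (IsUltrametricDist.norm_add_le_max _ _).trans (max_le ?_ ?_)
      · exact IsUltrametricDist.norm_sum_le_of_forall_le_of_nonneg (hB 0) fun r hr =>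
          IsUltrametricDist.norm_sum_le_of_forall_le_of_nonneg (hB 0) fun j' _ =>
          h1 r (mem_range.1 hr) _ j' 0
      · exact IsUltrametricDist.norm_sum_le_of_forall_le_of_nonneg (hB 0) fun j' _ =>
          h2 0 (pow_pos hp.out.pos _) j' 0
    · rw [norm_zero]; exact hB l
    · rw [norm_zero]; exact hB l

/-- Division by `n`, after multiplication by `p ^ α`, gains a factor `p`. The index is shifted on the disk
around `0`. -/
theorem FamBound.div (hα : 1 ≤ α) {b : ℕ → ℝ} (hb : Monotone b) {C : ℕ → Fin N → ℕ → K}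
    (h : FamBound p α b C) : FamBound p α (fun l => (p : ℝ)⁻¹ * b (l + 1)) (divFam p α C) := by
  intro r hr i
  unfold divFam
  split_ifs with h0
  · exact (h 0 (pow_pos hp.out.pos _) i).shift hα
  · refine ((h r hr i).div hα hb norm_prime_pow (norm_natCast_inv_le p h0 hr)).mono fun l => ?_
    exact mul_le_mul_of_nonneg_left (hb l.le_succ) (by positivity)

omit hp [NormedAlgebra ℚ_[p] K] [IsUltrametricDist K] in
theorem FamBound.mono {b b' : ℕ → ℝ} {C : ℕ → Fin N → ℕ → K} (h : FamBound p α b C)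
    (hb : ∀ l, b l ≤ b' l) : FamBound p α b' C := fun r hr i => (h r hr i).mono hb

omit hp [NormedAlgebra ℚ_[p] K] [IsUltrametricDist K] in
/-- Enlarging the parameters of a polynomial bound, so that it becomes `Slow` again. -/
theorem famGrowth_of_bound {A : ℝ} (hA : 0 ≤ A) {m k : ℕ} {C : ℕ → Fin N → ℕ → K}
    (h : FamBound p α (fun l => A * ((l : ℝ) + m) ^ k) C) : FamGrowth p α C := by
  refine ⟨A, m + 2 * k + 1, k, hA, by omega, by omega, h.mono fun l => ?_⟩
  have : (l : ℝ) + m ≤ l + (m + 2 * k + 1 : ℕ) := by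
    push_cast
    linarith [Nat.cast_nonneg (α := ℝ) k]
  gcongr

omit hp in
theorem pow_denominator_mul_le {A : ℝ} (hA : 0 ≤ A) {m : ℕ} (hm : 1 ≤ m) (k l : ℕ) :
    (p : ℝ) ^ (1 + padicValNat p l) * (A * ((l : ℝ) + m) ^ k) ≤
      p * A * ((l : ℝ) + m) ^ (k + 1) := by
  have hm' : (1 : ℝ) ≤ m := by exact_mod_cast hm
  have h1 : (p : ℝ) ^ padicValNat p l ≤ l + m := (pow_padicValNat_le l).trans (by linarith)
  calc (p : ℝ) ^ (1 + padicValNat p l) * (A * ((l : ℝ) + m) ^ k)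
      = (p : ℝ) ^ padicValNat p l * (p * A * ((l : ℝ) + m) ^ k) := by rw [pow_add, pow_one]; ring
    _ ≤ (l + m) * (p * A * ((l : ℝ) + m) ^ k) := by gcongr
    _ = _ := by rw [pow_succ]; ring

theorem FamGrowth.mul (hN : ¬ p ∣ N) (hξ : ξ ^ N = 1) (hα : 1 ≤ α) {C : ℕ → Fin N → ℕ → K}
    (h : FamGrowth p α C) (i₀ : Fin N) : FamGrowth p α (mulCoeff p α ξ i₀ C) := by
  obtain ⟨A, m, k, hA, hmk, hm, hC⟩ := h
  refine famGrowth_of_bound (A := p * A) (m := m) (k := k + 1) (by positivity)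
    ((hC.mul hN hξ hα (slow_pow hA hmk) i₀).mono fun l => pow_denominator_mul_le hA hm k l)

theorem FamGrowth.div (hα : 1 ≤ α) {C : ℕ → Fin N → ℕ → K} (h : FamGrowth p α C) :
    FamGrowth p α (divFam p α C) := by
  obtain ⟨A, m, k, hA, hmk, -, hC⟩ := h
  refine famGrowth_of_bound (A := (p : ℝ)⁻¹ * A) (m := m + 1) (k := k) (by positivity)
    ((hC.div hα (slow_pow (p := p) hA hmk).mono).mono fun l => le_of_eq ?_)
  push_cast
  ring

variable [CompleteSpace K]

omit [IsUltrametricDist K] [NormedAlgebra ℚ_[p] K] in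
theorem FamGrowth.hasSum (hα : 1 ≤ α) {C : ℕ → Fin N → ℕ → K} (h : FamGrowth p α C) {r : ℕ}
    (hr : r < p ^ α) (i : Fin N) {x : K} (hx : ‖x‖ ≤ ((p : ℝ) ^ α)⁻¹) :
    HasSum (fun l => C r i l * x ^ l) (ev (C r i) x) := by
  obtain ⟨A, m, k, -, -, -, hC⟩ := h
  exact (hC r hr i).hasSum hα hx

omit [IsUltrametricDist K] [CompleteSpace K] in
theorem norm_prime_pow_mul_le (u : ℕ) : ‖(p : K) ^ α * u‖ ≤ ((p : ℝ) ^ α)⁻¹ := by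
  rw [norm_mul, norm_prime_pow]
  exact mul_le_of_le_one_right (by positivity) (norm_natCast_le_one p u)

omit [IsUltrametricDist K] [CompleteSpace K] [NormedAlgebra ℚ_[p] K] hp in
theorem ev_zero (c : ℕ → K) : ev c 0 = c 0 := by
  rw [ev, tsum_eq_single 0 fun l hl => by simp [hl]]
  simp

/-- The expansion of the product of a power series with `z / (z - ξ ^ i₀)`. -/
theorem SeqExpansion.mul (hN : ¬ p ∣ N) (hξ : ξ ^ N = 1) (hα : 1 ≤ α) {C : ℕ → Fin N → ℕ → K}
    (hC : FamGrowth p α C) {G : ℕ → K} (hG : SeqExpansion p α ξ 0 G C) (i₀ : Fin N) :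
    SeqExpansion p α ξ 1
      (fun n => -∑ k ∈ Ico 1 n, (ξ ^ (i₀ : ℕ))⁻¹ ^ (n - k) * G k) (mulCoeff p α ξ i₀ C) := by
  intro r₀ hr₀ u hn
  have hN0 : N ≠ 0 := fun h => hN (h ▸ dvd_zero p)
  have hξ0 : ξ ≠ 0 := by rintro rfl; rw [zero_pow hN0] at hξ; exact zero_ne_one hξ
  have hpow : ∀ (i n : ℕ), (ξ ^ i)⁻¹ ^ n = ξ ^ (-((i : ℤ) * n)) := fun i n => by
    rw [zpow_neg, zpow_mul, zpow_natCast, zpow_natCast, inv_pow]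
  set x : K := (p : K) ^ α * u with hx
  have hxn : ‖x‖ ≤ ((p : ℝ) ^ α)⁻¹ := norm_prime_pow_mul_le u
  set n := p ^ α * u + r₀ with hn_def
  set c' : ℕ → Fin N → ℕ → K := fun r j =>
    powSumCoeff p α (ξ ^ (((i₀ : ℤ) - j) * (p : ℤ) ^ α)) (C r j) with hc'
  obtain ⟨A, m, k, hA, hmk, hm, hCb⟩ := hC
  have hpos : 0 < p ^ α := pow_pos hp.out.pos _
  have hev : ∀ r < p ^ α, ∀ j, HasSum (fun l => C r j l * x ^ l) (ev (C r j) x) := fun r hr j =>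
    (hCb r hr j).hasSum hα hxn
  have hev' : ∀ r < p ^ α, ∀ j, HasSum (fun l => c' r j l * x ^ l) (ev (c' r j) x) := by
    intro r hr j
    refine CoeffBound.hasSum (A := p * A) (m := m) (k := k + 1) hα
      (((hCb r hr j).powSum hN (root_zpow_pow hξ _) hα (slow_pow hA hmk)).mono
        fun l => pow_denominator_mul_le hA hm k l) hxn
  set Q : K := ∑ r ∈ range (p ^ α), ∑ j : Fin N, ξ ^ (((i₀ : ℤ) - j) * r) * c' r j 0 with hQ
  set G0 : K := ∑ j : Fin N, C 0 j 0 with hG0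
  -- Evaluation of the coefficients of the product at `x = p ^ α u`.
  have hmul : ∀ j, ev (mulCoeff p α ξ i₀ C r₀ j) x =
      -(∑ r ∈ range (p ^ α), ξ ^ (((j : ℤ) - i₀) * r₀ + ((i₀ : ℤ) - j) * r) * ev (c' r j) x) -
      ∑ r ∈ range r₀, ξ ^ (((j : ℤ) - i₀) * ((r₀ : ℤ) - r)) * ev (C r j) x +
      if j = i₀ then Q + G0 else 0 := by
    intro j
    have hs1 : HasSum (fun l => ∑ r ∈ range (p ^ α),
        ξ ^ (((j : ℤ) - i₀) * r₀ + ((i₀ : ℤ) - j) * r) * (c' r j l * x ^ l))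
        (∑ r ∈ range (p ^ α), ξ ^ (((j : ℤ) - i₀) * r₀ + ((i₀ : ℤ) - j) * r) * ev (c' r j) x) :=
      hasSum_sum fun r hr => (hev' r (mem_range.1 hr) j).mul_left _
    have hs2 : HasSum (fun l => ∑ r ∈ range r₀,
        ξ ^ (((j : ℤ) - i₀) * ((r₀ : ℤ) - r)) * (C r j l * x ^ l))
        (∑ r ∈ range r₀, ξ ^ (((j : ℤ) - i₀) * ((r₀ : ℤ) - r)) * ev (C r j) x) :=
      hasSum_sum fun r hr => (hev r ((mem_range.1 hr).trans hr₀) j).mul_left _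
    have hs3 : HasSum (fun l : ℕ => if l = 0 then (if j = i₀ then Q + G0 else 0) else 0)
        (if j = i₀ then Q + G0 else 0) := hasSum_ite_eq 0 _
    refine HasSum.tsum_eq (Eq.subst (motive := fun g => HasSum g _) (funext fun l => ?_)
      ((hs1.neg.sub hs2).add hs3))
    rw [mulCoeff, add_mul _ _ (x ^ l), sub_mul _ _ (x ^ l), neg_mul _ (x ^ l), sum_mul, sum_mul]
    congr 1
    · congr 1
      · exact congrArg _ (sum_congr rfl fun r _ => (mul_assoc _ _ _).symm)
      · exact sum_congr rfl fun r _ => (mul_assoc _ _ _).symm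
    · split_ifs with h1 h2
      · subst h1; rw [pow_zero, mul_one]
      · rw [zero_mul]
      · rw [zero_mul]
  -- The sum over `0 < k < n`, with the power of `ξ ^ i₀` taken out and the term at `0` added.
  have hleft : ∑ k ∈ Ico 1 n, (ξ ^ (i₀ : ℕ))⁻¹ ^ (n - k) * G k =
      ξ ^ (-((i₀ : ℤ) * n)) * (∑ k ∈ range n, ξ ^ ((i₀ : ℤ) * k) * G k - G 0) := by
    rw [range_eq_Ico, sum_eq_sum_Ico_succ_bot hn]
    simp only [Nat.cast_zero, mul_zero, zpow_zero, one_mul, zero_add, add_sub_cancel_left, mul_sum]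
    refine sum_congr rfl fun k hk => ?_
    have hkn : k ≤ n := (mem_Ico.1 hk).2.le
    rw [hpow, ← mul_assoc, ← zpow_add₀ hξ0]
    congr 2
    push_cast [hkn]
    ring
  have hG0' : G 0 = G0 := by
    have := hG 0 hpos 0 (Nat.zero_le _)
    simpa [ev_zero] using this
  have hGk : ∀ r < p ^ α, ∀ t : ℕ, ξ ^ ((i₀ : ℤ) * ((p ^ α * t + r : ℕ) : ℤ)) * G (p ^ α * t + r) =
      ∑ j : Fin N, ξ ^ (((i₀ : ℤ) - j) * r) * ((ξ ^ (((i₀ : ℤ) - j) * (p : ℤ) ^ α)) ^ t *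
        ev (C r j) ((p : K) ^ α * t)) := by
    intro r hr t
    rw [hG r hr t (Nat.zero_le _), mul_sum]
    refine sum_congr rfl fun j _ => ?_
    rw [hpow, ← mul_assoc, ← mul_assoc, ← zpow_natCast (ξ ^ (((i₀ : ℤ) - j) * (p : ℤ) ^ α)),
      ← zpow_mul, ← zpow_add₀ hξ0, ← zpow_add₀ hξ0]
    congr 2
    push_cast
    ring
  -- The classes `r < p ^ α` contribute power sums over `t < u`, and the classes `r < r₀` in addition
  -- their term with `t = u`.
  have hsum : ∑ k ∈ range n, ξ ^ ((i₀ : ℤ) * k) * G k =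
      ∑ j : Fin N, (∑ r ∈ range (p ^ α), ξ ^ (((i₀ : ℤ) - j) * r) *
          ((ξ ^ (((i₀ : ℤ) - j) * (p : ℤ) ^ α)) ^ u * ev (c' r j) x) +
        ∑ r ∈ range r₀, ξ ^ (((i₀ : ℤ) - j) * r) *
          ((ξ ^ (((i₀ : ℤ) - j) * (p : ℤ) ^ α)) ^ u * ev (C r j) x)) - Q := by
    rw [hn_def, sum_range_mul_add, sum_add_distrib, sum_comm (t := range r₀),
      sum_comm (t := range (p ^ α)), add_sub_right_comm, hQ, ← sum_sub_distrib]
    congr 1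
    · refine sum_congr rfl fun r hr => ?_
      have hr' := mem_range.1 hr
      rw [sum_congr rfl fun t _ => hGk r hr' t, sum_comm, ← sum_sub_distrib]
      refine sum_congr rfl fun j _ => ?_
      rw [← mul_sum, (hCb r hr' j).sum_ev hN (root_zpow_pow hξ _) hα hA, mul_sub]
    · exact sum_congr rfl fun r hr => hGk r ((mem_range.1 hr).trans hr₀) u
  dsimp only
  rw [hleft, hsum, hG0']
  have hterm : ∀ j : Fin N, (ξ ^ (j : ℕ))⁻¹ ^ n * ev (mulCoeff p α ξ i₀ C r₀ j) x =
      -(ξ ^ (-((i₀ : ℤ) * n)) * (∑ r ∈ range (p ^ α), ξ ^ (((i₀ : ℤ) - j) * r) *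
          ((ξ ^ (((i₀ : ℤ) - j) * (p : ℤ) ^ α)) ^ u * ev (c' r j) x) +
        ∑ r ∈ range r₀, ξ ^ (((i₀ : ℤ) - j) * r) *
          ((ξ ^ (((i₀ : ℤ) - j) * (p : ℤ) ^ α)) ^ u * ev (C r j) x))) +
      if j = i₀ then ξ ^ (-((i₀ : ℤ) * n)) * (Q + G0) else 0 := by
    intro j
    have hn' : (n : ℤ) = (p : ℤ) ^ α * u + r₀ := by rw [hn_def]; push_cast; rfl
    have hexp : ∀ (r : ℕ) (a : ℤ) (y : K),
        a = ((j : ℤ) - i₀) * r₀ + ((i₀ : ℤ) - j) * r →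
        ξ ^ (-((j : ℤ) * n)) * (ξ ^ a * y) = ξ ^ (-((i₀ : ℤ) * n)) * (ξ ^ (((i₀ : ℤ) - j) * r) *
          ((ξ ^ (((i₀ : ℤ) - j) * (p : ℤ) ^ α)) ^ u * y)) := by
      rintro r a y rfl
      rw [← zpow_natCast (ξ ^ (((i₀ : ℤ) - j) * (p : ℤ) ^ α)), ← zpow_mul, ← mul_assoc, ← mul_assoc,
        ← mul_assoc, ← zpow_add₀ hξ0, ← zpow_add₀ hξ0, ← zpow_add₀ hξ0, hn']
      congr 2
      ring
    have hj : j = i₀ → ξ ^ (-((j : ℤ) * n)) = ξ ^ (-((i₀ : ℤ) * n)) := by rintro rfl; rfl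
    rw [hpow, hmul, mul_add, mul_sub, mul_neg, mul_sum, mul_sum, mul_add, mul_sum, mul_sum, neg_add,
      ← sub_eq_add_neg]
    congr 1
    · congr 1
      · exact congrArg _ (sum_congr rfl fun r _ => hexp r _ _ rfl)
      · exact sum_congr rfl fun r _ => hexp r _ _ (by ring)
    · split_ifs with h
      · rw [hj h]
      · rw [mul_zero]
  rw [sum_congr rfl fun j _ => hterm j]
  refine Eq.trans ?_ sum_add_distrib.symm
  rw [sum_neg_distrib, ← mul_sum, sum_ite_eq', if_pos (mem_univ _)]
  ring

end Families

/-! ### Growth conditions -/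

section Growth

variable {p : ℕ} [hp : Fact p.Prime] {α : ℕ} {K : Type*} [NormedField K]

/-- The growth condition of `SeqGrowth` is a polynomial bound. -/
theorem prime_rpow_log (κ κ' : ℝ) {y : ℝ} (hy : 0 < y) (hα : 1 ≤ α) (l : ℕ) :
    (p : ℝ) ^ (κ + κ' / Real.log p * Real.log y + ((α : ℝ) - 1) * l) =
      (p : ℝ) ^ κ * y ^ κ' * ((p : ℝ) ^ (α - 1)) ^ l := by
  have hp1 := one_lt_prime_real p
  have hp0 : (0 : ℝ) < p := by linarith
  have hlog : Real.log p ≠ 0 := (Real.log_pos hp1).ne'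
  rw [Real.rpow_add hp0, Real.rpow_add hp0]
  congr 1
  · congr 1
    rw [Real.rpow_def_of_pos hp0, Real.rpow_def_of_pos hy]
    congr 1
    field_simp
  · rw [← pow_mul, ← Real.rpow_natCast]
    push_cast [hα]
    rfl

theorem CoeffBound.seqGrowth (hα : 1 ≤ α) {A : ℝ} (hA : 0 ≤ A) {m k : ℕ} (hm : 1 ≤ m) {c : ℕ → K}
    (h : CoeffBound p α (fun l => A * ((l : ℝ) + m) ^ k) c) : SeqGrowth p α c := by
  have hp1 := one_lt_prime_real p
  have hp0 : (0 : ℝ) < p := by linarith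
  have hlog : 0 < Real.log p := Real.log_pos hp1
  have hm' : (1 : ℝ) ≤ m := by exact_mod_cast hm
  refine ⟨Real.log (A + 1) / Real.log p + 1, k + 1, m, ?_, by positivity, by linarith, fun l => ?_⟩
  · have : 0 ≤ Real.log (A + 1) := Real.log_nonneg (by linarith)
    positivity
  have hy1 : (1 : ℝ) ≤ l + m := by linarith [Nat.cast_nonneg (α := ℝ) l]
  rw [prime_rpow_log _ _ (by linarith) hα]
  refine (h l).trans (mul_le_mul_of_nonneg_right ?_ (by positivity))
  refine mul_le_mul ?_ ?_ (by positivity) (by positivity)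
  · rw [Real.rpow_add hp0, Real.rpow_one, Real.rpow_def_of_pos hp0, mul_div_cancel₀ _ hlog.ne',
      Real.exp_log (by linarith)]
    nlinarith
  · rw [← Real.rpow_natCast]
    exact Real.rpow_le_rpow_of_exponent_le hy1 (by linarith)

theorem SeqGrowth.coeffBound (hα : 1 ≤ α) {c : ℕ → K} (h : SeqGrowth p α c) :
    ∃ (A : ℝ) (m k : ℕ), CoeffBound p α (fun l => A * ((l : ℝ) + m) ^ k) c := by
  obtain ⟨κ, κ', κ'', -, hκ', hκ'', h⟩ := h
  refine ⟨(p : ℝ) ^ κ, ⌈κ''⌉₊ + 1, ⌈κ'⌉₊, fun l => (h l).trans ?_⟩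
  have hl := Nat.cast_nonneg (α := ℝ) l
  rw [prime_rpow_log _ _ (by positivity) hα]
  refine mul_le_mul_of_nonneg_right (mul_le_mul_of_nonneg_left ?_ (by positivity)) (by positivity)
  have h1 : (l : ℝ) + κ'' ≤ l + (⌈κ''⌉₊ + 1 : ℕ) := by
    push_cast
    linarith [Nat.le_ceil κ'']
  refine (Real.rpow_le_rpow (by positivity) h1 hκ'.le).trans ?_
  rw [← Real.rpow_natCast]
  refine Real.rpow_le_rpow_of_exponent_le ?_ (Nat.le_ceil κ')
  push_cast
  linarith [Nat.cast_nonneg (α := ℝ) ⌈κ''⌉₊]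

end Growth

/-! ### Construction of the regularization -/

section Regularization

variable {p : ℕ} [hp : Fact p.Prime] {α N : ℕ} {K : Type*} [NormedField K] [NormedAlgebra ℚ_[p] K]
  {ξ : K}

omit [NormedAlgebra ℚ_[p] K] in
theorem hasSum_family [CompleteSpace K] (hα : 1 ≤ α) {C : ℕ → Fin N → ℕ → K}
    (hC : FamGrowth p α C) {r : ℕ} (hr : r < p ^ α) (e : Fin N → K) {x : K}
    (hx : ‖x‖ ≤ ((p : ℝ) ^ α)⁻¹) :
    HasSum (fun l => ∑ i : Fin N, C r i l * e i * x ^ l) (∑ i : Fin N, e i * ev (C r i) x) := by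
  refine hasSum_sum fun i _ => Eq.subst (motive := fun g => HasSum g _) (funext fun l => ?_)
    ((hC.hasSum hα hr i hx).mul_left (e i))
  ring

/-- Division by `n` of a sequence with expansions yields an element of `LAE^pol`. -/
theorem SeqExpansion.div [CompleteSpace K] [IsUltrametricDist K] (hα : 1 ≤ α)
    {C : ℕ → Fin N → ℕ → K} (hC : FamGrowth p α C) {h g : ℕ → K} (hh : SeqExpansion p α ξ 1 h C)
    (hg : ∀ n, 1 ≤ n → g n = (p : K) ^ α * h n / n) :
    IsPolExpansion p α ξ g (fun i => (p : K) ^ α * C 0 i 0) (divFam p α C) := by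
  have := charZero_of_padic p K
  have hpos : 0 < p ^ α := pow_pos hp.out.pos _
  have hD := hC.div hα
  refine ⟨fun r hr i => ?_, fun r hr n hn hnr => ?_⟩
  · obtain ⟨A, m, k, hA, -, hm, hb⟩ := hD
    exact (hb r hr i).seqGrowth hα hA hm
  obtain ⟨A, m, k, hA, -, hm, hb⟩ := id hC
  set u := n / p ^ α with hu
  have hnu : n = p ^ α * u + r := by
    have h1 : n % p ^ α = r := by rw [hnr, Nat.mod_eq_of_lt hr]
    rw [← h1, hu, Nat.div_add_mod]
  have hx := norm_prime_pow_mul_le (p := p) (α := α) (K := K) u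
  have hxn : (n : K) - r = (p : K) ^ α * u := by rw [hnu]; push_cast; ring
  have hn0 : (n : K) ≠ 0 := by exact_mod_cast (by omega : n ≠ 0)
  have hh' := hh r hr u (hnu ▸ hn)
  rw [← hnu] at hh'
  rw [hxn, hg n hn, hh']
  convert hasSum_family hα hD hr (fun i => (ξ ^ (i : ℕ))⁻¹ ^ n) hx using 1
  have hn' : (n : K) = r + (p : K) ^ α * u := by rw [hnu]; push_cast; ring
  split_ifs with h0
  · rw [mul_sum, sum_div, ← sum_sub_distrib]
    refine sum_congr rfl fun i _ => ?_
    have h1 := (hb 0 hpos i).ev_shift hα hx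
    have h2 : ev (divFam p α C r i) ((p : K) ^ α * u) =
        (p : K) ^ α * ev (fun l => C 0 i (l + 1)) ((p : K) ^ α * u) := by
      rw [divFam, if_pos h0, ev, ev, ← tsum_mul_left]
      exact tsum_congr fun l => mul_assoc _ _ _
    have h3 : (p : K) ^ α * u = n := by rw [hn', h0]; push_cast; ring
    rw [h2]
    subst h0
    rw [h3] at h1 ⊢
    generalize (ξ ^ (i : ℕ))⁻¹ ^ n = e
    field_simp
    linear_combination -(p : K) ^ α * e * h1
  · rw [sub_zero, mul_sum, sum_div]
    refine sum_congr rfl fun i _ => ?_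
    have hr0 : (r : K) ≠ 0 := by exact_mod_cast h0
    have h1 := (hb r hr i).ev_div hα hA norm_prime_pow hr0 (norm_natCast_inv_le p h0 hr) hx
    rw [← hn'] at h1
    rw [divFam, if_neg h0]
    generalize (ξ ^ (i : ℕ))⁻¹ ^ n = e
    field_simp
    linear_combination -e * h1

variable (p α ξ) in
/-- The function on `ℤ_p^{(N)}` given by the expansions with coefficients `C`. -/
noncomputable def extend (C : ℕ → Fin N → ℕ → K) (n : ZpN p N) : K :=
  ∑ i : Fin N, (ξ ^ (i : ℕ))⁻¹ ^ n.1.val * ev (C (n.2.appr α) i)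
    (algebraMap ℚ_[p] K ((n.2 - (n.2.appr α : ℤ_[p]) : ℤ_[p]) : ℚ_[p]))

theorem norm_sub_appr (x : ℤ_[p]) : ‖x - (x.appr α : ℤ_[p])‖ ≤ (p : ℝ) ^ (-(α : ℤ)) :=
  (PadicInt.norm_le_pow_iff_mem_span_pow _ _).2 (PadicInt.appr_spec α x)

theorem eq_appr_of_norm_le {x : ℤ_[p]} {r : ℕ} (hr : r < p ^ α)
    (h : ‖x - (r : ℤ_[p])‖ ≤ (p : ℝ) ^ (-(α : ℤ))) : r = x.appr α := by
  have h1 : ‖((((x.appr α : ℤ) - r : ℤ)) : ℤ_[p])‖ ≤ (p : ℝ) ^ (-(α : ℤ)) := by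
    have : ((((x.appr α : ℤ) - r : ℤ)) : ℤ_[p]) = (x - r) - (x - x.appr α) := by push_cast; ring
    rw [this]
    exact (norm_sub_le_max' _ _).trans (max_le h (norm_sub_appr x))
  have h2 := PadicInt.norm_int_le_pow_iff_dvd.1 h1
  exact Nat.ModEq.eq_of_lt_of_lt (Nat.modEq_iff_dvd.2 (by exact_mod_cast h2)) hr (x.appr_lt α)

theorem norm_algebraMap_padicInt_le {x : ℤ_[p]} (h : ‖x‖ ≤ (p : ℝ) ^ (-(α : ℤ))) :
    ‖algebraMap ℚ_[p] K (x : ℚ_[p])‖ ≤ ((p : ℝ) ^ α)⁻¹ := by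
  rw [norm_algebraMap' K, PadicInt.padic_norm_e_of_padicInt]
  rwa [zpow_neg, zpow_natCast] at h

theorem isExpansion_extend [CompleteSpace K] (hα : 1 ≤ α) {C : ℕ → Fin N → ℕ → K}
    (hC : FamGrowth p α C) : IsExpansion p α ξ (extend p α ξ C) C := by
  refine ⟨fun r hr i => ?_, fun r hr n hn => ?_⟩
  · obtain ⟨A, m, k, hA, -, hm, hb⟩ := hC
    exact (hb r hr i).seqGrowth hα hA hm
  · rw [extend, ← eq_appr_of_norm_le hr hn]
    exact hasSum_family hα hC hr _ (norm_algebraMap_padicInt_le hn)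

theorem extend_natCast (hξ : ξ ^ N = 1) (C : ℕ → Fin N → ℕ → K) {r : ℕ} (hr : r < p ^ α) (u : ℕ) :
    extend p α ξ C ((p ^ α * u + r : ℕ) : ZpN p N) =
      ∑ i : Fin N, (ξ ^ (i : ℕ))⁻¹ ^ (p ^ α * u + r) * ev (C r i) ((p : K) ^ α * u) := by
  set n := p ^ α * u + r with hn
  have h1 : ((n : ZpN p N).2 : ℤ_[p]) - (r : ℤ_[p]) = (p : ℤ_[p]) ^ α * u := by
    rw [Prod.snd_natCast, hn]; push_cast; ring
  have h2 : ‖(n : ZpN p N).2 - (r : ℤ_[p])‖ ≤ (p : ℝ) ^ (-(α : ℤ)) := by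
    rw [h1]
    exact (PadicInt.norm_le_pow_iff_mem_span_pow _ _).2
      (Ideal.mem_span_singleton.2 (dvd_mul_right _ _))
  rw [extend, ← eq_appr_of_norm_le hr h2, h1]
  refine sum_congr rfl fun i _ => ?_
  congr 1
  · rw [Prod.fst_natCast, ZMod.val_natCast]
    refine (pow_eq_pow_mod n ?_).symm
    rw [inv_pow, ← pow_mul, mul_comm, pow_mul, hξ, one_pow, inv_one]
  · congr 1
    push_cast
    simp

theorem norm_extend_le [IsUltrametricDist K] (hN : ¬ p ∣ N) (hξ : ξ ^ N = 1) (hα : 1 ≤ α)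
    {b : ℕ → ℝ} {C : ℕ → Fin N → ℕ → K} (hC : FamBound p α b C) {B : ℝ} (hB : 0 ≤ B)
    (hb : ∀ l, b l * (p : ℝ)⁻¹ ^ l ≤ B) (n : ZpN p N) : ‖extend p α ξ C n‖ ≤ B := by
  have hN0 : N ≠ 0 := fun h => hN (h ▸ dvd_zero p)
  refine IsUltrametricDist.norm_sum_le_of_forall_le_of_nonneg hB fun i _ => ?_
  rw [norm_mul, norm_pow, norm_inv, norm_pow, norm_root_of_unity hN0 hξ, one_pow, inv_one, one_pow,
    one_mul]
  exact IsUltrametricDist.norm_tsum_le_of_forall_le_of_nonneg hB fun l =>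
    ((hC _ (n.2.appr_lt α) i).norm_term_le hα
      (norm_algebraMap_padicInt_le (norm_sub_appr n.2)) l).trans (hb l)

/-- A sequence in `LAE^pol` has a regularization: drop the polar terms and extend the expansions. -/
theorem IsPolExpansion.isRegularization_extend [CompleteSpace K] (hξ : ξ ^ N = 1) (hα : 1 ≤ α)
    {g : ℕ → K} {a : Fin N → K} {C : ℕ → Fin N → ℕ → K} (hg : IsPolExpansion p α ξ g a C)
    (hC : FamGrowth p α C) : IsRegularization p α ξ g (extend p α ξ C) := by
  refine ⟨a, C, hg, ⟨C, isExpansion_extend hα hC⟩, fun n hn => ?_⟩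
  have hr : n % p ^ α < p ^ α := Nat.mod_lt _ (pow_pos hp.out.pos _)
  have h1 := hg.2 (n % p ^ α) hr n hn (Nat.mod_modEq n _).symm
  have hnu : p ^ α * (n / p ^ α) + n % p ^ α = n := Nat.div_add_mod n _
  have h2 := extend_natCast hξ C hr (n / p ^ α)
  have h3 := hasSum_family hα hC hr (fun i => (ξ ^ (i : ℕ))⁻¹ ^ n)
    (norm_prime_pow_mul_le (p := p) (α := α) (K := K) (n / p ^ α))
  have hxn : (n : K) - (n % p ^ α : ℕ) = (p : K) ^ α * (n / p ^ α : ℕ) := by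
    rw [sub_eq_iff_eq_add, ← Nat.cast_pow, ← Nat.cast_mul, ← Nat.cast_add, hnu]
  rw [hnu] at h2
  rw [hxn] at h1
  rw [h2, h3.unique h1]
  congr 1
  simp only [polar, Nat.dvd_iff_mod_eq_zero]
  split_ifs with h0
  · exact sum_congr rfl fun i _ => by rw [mul_div_assoc', div_eq_mul_inv]
  · simp

end Regularization

/-! ### Uniqueness of the regularization -/

section Uniqueness

variable {p : ℕ} [hp : Fact p.Prime] {α N : ℕ} {K : Type*} [NormedField K] [NormedAlgebra ℚ_[p] K]
  [CompleteSpace K] {ξ : K}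

theorem IsLAE.continuous_snd (hα : 1 ≤ α) {F : ZpN p N → K} (hF : IsLAE p α ξ F) (c : ZMod N) :
    Continuous fun x : ℤ_[p] => F (c, x) := by
  obtain ⟨C, hgrowth, hsum⟩ := hF
  refine continuous_iff_continuousAt.2 fun x => ?_
  have hp0 : (0 : ℝ) < p := one_pos.trans (one_lt_prime_real p)
  set r := x.appr α with hr
  have hrlt : r < p ^ α := x.appr_lt α
  set U := Metric.closedBall x ((p : ℝ) ^ (-(α : ℤ))) with hU
  have hUn : U ∈ nhds x := Metric.closedBall_mem_nhds x (by positivity)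
  have hUr : ∀ y ∈ U, ‖y - (r : ℤ_[p])‖ ≤ (p : ℝ) ^ (-(α : ℤ)) := by
    intro y hy
    rw [hU, Metric.mem_closedBall, dist_eq_norm] at hy
    rw [← sub_add_sub_cancel y x]
    exact (IsUltrametricDist.norm_add_le_max _ _).trans (max_le hy (norm_sub_appr x))
  choose A m k hb using fun i => (hgrowth r hrlt i).coeffBound hα
  set e : Fin N → K := fun i => (ξ ^ (i : ℕ))⁻¹ ^ c.val
  have hcont : ContinuousOn (fun y : ℤ_[p] => ∑' l : ℕ, ∑ i : Fin N, C r i l * e i *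
      algebraMap ℚ_[p] K ((y - (r : ℤ_[p]) : ℤ_[p]) : ℚ_[p]) ^ l) U := by
    refine continuousOn_tsum (s := U) (f := fun (l : ℕ) (y : ℤ_[p]) => ∑ i : Fin N, C r i l * e i *
      algebraMap ℚ_[p] K ((y - (r : ℤ_[p]) : ℤ_[p]) : ℚ_[p]) ^ l) (u := fun l : ℕ => ∑ i : Fin N, ‖e i‖ *
      (A i * (((l : ℝ) + m i) ^ k i * (p : ℝ)⁻¹ ^ l))) (fun l => ?_) ?_ fun l y hy => ?_
    · have h1 : Continuous fun y : ℤ_[p] =>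
          algebraMap ℚ_[p] K ((y - (r : ℤ_[p]) : ℤ_[p]) : ℚ_[p]) :=
        (continuous_algebraMap ℚ_[p] K).comp
          ((continuous_subtype_val (p := fun y : ℚ_[p] => ‖y‖ ≤ 1)).comp
            (continuous_id.sub continuous_const))
      have h2 : Continuous fun y : ℤ_[p] => ∑ i : Fin N, C r i l * e i *
          algebraMap ℚ_[p] K ((y - (r : ℤ_[p]) : ℤ_[p]) : ℚ_[p]) ^ l :=
        continuous_finsetSum _ fun i _ => continuous_const.mul (h1.pow l)
      exact h2.continuousOn
    · exact summable_sum fun i _ =>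
        ((summable_pow_mul_inv_pow (one_lt_prime_real p) (m i) (k i)).mul_left _).mul_left _
    · refine (norm_sum_le _ _).trans (sum_le_sum fun i _ => ?_)
      rw [mul_comm (C r i l), mul_assoc, norm_mul]
      refine mul_le_mul_of_nonneg_left ?_ (norm_nonneg _)
      rw [← mul_assoc]
      exact (hb i).norm_term_le hα (norm_algebraMap_padicInt_le (hUr y hy)) l
  refine ContinuousAt.congr (hcont.continuousAt hUn) ?_
  filter_upwards [hUn] with y hy
  exact (hsum r hrlt (c, y) (hUr y hy)).tsum_eq

/-- The positive integers with a given class modulo `N` are dense in `ℤ_p`. -/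
theorem exists_tendsto_natCast (hN : ¬ p ∣ N) (c : ZMod N) (x : ℤ_[p]) :
    ∃ n : ℕ → ℕ, (∀ k, 1 ≤ n k ∧ ((n k : ℕ) : ZMod N) = c) ∧
      Filter.Tendsto (fun k => ((n k : ℕ) : ℤ_[p])) Filter.atTop (nhds x) := by
  have hN0 : N ≠ 0 := fun h => hN (h ▸ dvd_zero p)
  have : NeZero N := ⟨hN0⟩
  have hco : ∀ k, Nat.Coprime N (p ^ k) := fun k =>
    (((Nat.Prime.coprime_iff_not_dvd hp.out).2 hN).symm).pow_right k
  set n : ℕ → ℕ := fun k => Nat.chineseRemainder (hco k) c.val (x.appr k) + N * p ^ k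
  refine ⟨n, fun k => ⟨?_, ?_⟩, ?_⟩
  · have : 0 < N * p ^ k := Nat.mul_pos (Nat.pos_of_ne_zero hN0) (pow_pos hp.out.pos k)
    simp only [n]; omega
  · have h1 := (Nat.chineseRemainder (hco k) c.val (x.appr k)).2.1
    have h2 := (ZMod.natCast_eq_natCast_iff _ _ _).2 h1
    simp only [n]
    push_cast
    rw [h2, ZMod.natCast_self, zero_mul, add_zero, ZMod.natCast_zmod_val]
  · rw [tendsto_iff_norm_sub_tendsto_zero]
    have hp1 := one_lt_prime_real p
    refine squeeze_zero (fun _ => norm_nonneg _) (fun k => ?_) (tendsto_pow_atTop_nhds_zero_of_lt_one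
      (by positivity) (inv_lt_one_of_one_lt₀ hp1))
    rw [← norm_neg, neg_sub, inv_pow, ← zpow_natCast, ← zpow_neg]
    have h1 := (Nat.chineseRemainder (hco k) c.val (x.appr k)).2.2
    have h2 : n k ≡ x.appr k [MOD p ^ k] := by
      simp only [n]
      exact (Nat.ModEq.add h1 (Nat.modEq_zero_iff_dvd.2 (dvd_mul_left _ _)))
    rw [← sub_add_sub_cancel x (x.appr k : ℤ_[p])]
    refine (IsUltrametricDist.norm_add_le_max _ _).trans (max_le (norm_sub_appr x) ?_)
    refine (PadicInt.norm_le_pow_iff_mem_span_pow _ _).2 (Ideal.mem_span_singleton.2 ?_)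
    have h3 := (Nat.modEq_iff_dvd.1 h2)
    have h4 := map_dvd (Int.castRingHom ℤ_[p]) h3
    simpa using h4

/-- A function in `LAE^reg` is determined by its values at the positive integers. -/
theorem IsLAE.eq_of_natCast_eq (hN : ¬ p ∣ N) (hα : 1 ≤ α) {F F' : ZpN p N → K}
    (hF : IsLAE p α ξ F) (hF' : IsLAE p α ξ F')
    (h : ∀ n : ℕ, 1 ≤ n → F (n : ZpN p N) = F' (n : ZpN p N)) : F = F' := by
  funext ⟨c, x⟩
  obtain ⟨n, hn, hx⟩ := exists_tendsto_natCast hN c x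
  have h1 := ((hF.continuous_snd hα c).tendsto x).comp hx
  have h2 := ((hF'.continuous_snd hα c).tendsto x).comp hx
  refine tendsto_nhds_unique h1 (h2.congr fun k => ?_)
  have h3 := h (n k) (hn k).1
  have h4 : ((n k : ℕ) : ZpN p N) = (c, ((n k : ℕ) : ℤ_[p])) := Prod.ext (hn k).2 rfl
  rw [h4] at h3
  exact h3.symm

/-- The regularization is unique: a non-trivial combination of the functions `f_i` is unbounded near
some element `(c, 0)`, whereas functions in `LAE^reg` are continuous. -/
theorem IsRegularization.unique (hN : ¬ p ∣ N) (hξ : ξ ^ N = 1) (hα : 1 ≤ α) {g : ℕ → K}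
    {F F' : ZpN p N → K} (hF : IsRegularization p α ξ g F) (hF' : IsRegularization p α ξ g F') :
    F = F' := by
  obtain ⟨a, -, -, hL, ha⟩ := hF
  obtain ⟨a', -, -, hL', ha'⟩ := hF'
  have hN0 : N ≠ 0 := fun h => hN (h ▸ dvd_zero p)
  have := charZero_of_padic p K
  have hdiff : ∀ n : ℕ, 1 ≤ n → F (n : ZpN p N) - F' (n : ZpN p N) =
      ∑ i : Fin N, (a' i - a i) * polar p α ξ i n := by
    intro n hn
    rw [ha n hn, ha' n hn, sub_sub_sub_cancel_left, ← sum_sub_distrib]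
    exact sum_congr rfl fun i _ => (sub_mul _ _ _).symm
  have hmod : ∀ (i n n' : ℕ), n ≡ n' [MOD N] → (ξ ^ i)⁻¹ ^ n = (ξ ^ i)⁻¹ ^ n' := by
    intro i n n' h
    have h1 : (ξ ^ i)⁻¹ ^ N = 1 := by
      rw [inv_pow, ← pow_mul, mul_comm, pow_mul, hξ, one_pow, inv_one]
    rw [pow_eq_pow_mod n h1, pow_eq_pow_mod n' h1, h]
  have hzero : ∀ c : ℕ, ∑ i : Fin N, (a' i - a i) * (ξ ^ (i : ℕ))⁻¹ ^ c = 0 := by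
    intro c
    -- Integers congruent to `c` modulo `N` that tend to `0` in `ℤ_p`.
    set n : ℕ → ℕ := fun k => (c + N) * p ^ (N.totient * (k + α)) with hn
    have hφ : 1 ≤ N.totient := Nat.totient_pos.2 (Nat.pos_of_ne_zero hN0)
    have hnmod : ∀ k, n k ≡ c [MOD N] := by
      intro k
      have h1 : p ^ N.totient ≡ 1 [MOD N] :=
        Nat.ModEq.pow_totient ((Nat.Prime.coprime_iff_not_dvd hp.out).2 hN)
      have h2 := (h1.pow (k + α))
      rw [one_pow, ← pow_mul] at h2
      have h3 := Nat.ModEq.mul (by simp [Nat.ModEq] : c + N ≡ c [MOD N]) h2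
      rwa [mul_one] at h3
    have hn1 : ∀ k, 1 ≤ n k := fun k =>
      Nat.mul_pos (by omega) (pow_pos hp.out.pos _)
    have hdvd : ∀ k, p ^ α ∣ n k := fun k =>
      (pow_dvd_pow p (by nlinarith)).trans (dvd_mul_left _ _)
    have hnorm : ∀ k, ‖((n k : ℕ) : ℤ_[p])‖ ≤ (p : ℝ)⁻¹ ^ k := by
      intro k
      simp only [hn]
      push_cast
      rw [norm_mul, norm_pow, PadicInt.norm_p]
      refine (mul_le_of_le_one_left (by positivity) (PadicInt.norm_le_one _)).trans ?_
      exact pow_le_pow_of_le_one (by positivity) (inv_le_one_of_one_le₀ (one_lt_prime_real p).le)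
        (by nlinarith)
    have hpow := tendsto_pow_atTop_nhds_zero_of_lt_one (r := (p : ℝ)⁻¹)
      (by positivity) (inv_lt_one_of_one_lt₀ (one_lt_prime_real p))
    have hlim : Filter.Tendsto (fun k => ((n k : ℕ) : ℤ_[p])) Filter.atTop (nhds 0) :=
      squeeze_zero_norm hnorm hpow
    have hlimK : Filter.Tendsto (fun k => ((n k : ℕ) : K)) Filter.atTop (nhds 0) := by
      refine squeeze_zero_norm (fun k => ?_) hpow
      rw [norm_natCast_eq_padic p]
      exact_mod_cast hnorm k
    have hcont := (((hL.continuous_snd hα (c : ZMod N)).sub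
      (hL'.continuous_snd hα (c : ZMod N))).tendsto 0).comp hlim
    have hprod := hcont.mul hlimK
    rw [mul_zero] at hprod
    refine tendsto_nhds_unique (tendsto_const_nhds.congr fun k => ?_) hprod
    have h4 : ((n k : ℕ) : ZpN p N) = ((c : ZMod N), ((n k : ℕ) : ℤ_[p])) :=
      Prod.ext ((ZMod.natCast_eq_natCast_iff _ _ _).2 (hnmod k)) rfl
    have h5 := hdiff (n k) (hn1 k)
    have hk0 : ((n k : ℕ) : K) ≠ 0 := by exact_mod_cast (by have := hn1 k; omega : n k ≠ 0)
    rw [h4] at h5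
    simp only [Function.comp_apply, Pi.sub_apply]
    rw [h5, sum_mul]
    refine sum_congr rfl fun i _ => ?_
    rw [polar, if_pos (hdvd k), hmod i _ _ (hnmod k)]
    field_simp
  refine hL.eq_of_natCast_eq hN hα hL' fun n hn => sub_eq_zero.1 ?_
  rw [hdiff n hn]
  simp only [polar]
  split_ifs with h
  · have := hzero n
    rw [← zero_div (n : K), ← this, sum_div]
    exact sum_congr rfl fun i _ => (mul_div_assoc _ _ _).symm
  · simp

end Uniqueness

/-! ### Construction of the iterated integrals -/

section IteratedIntegrals

open PowerSeries in
/-- The geometric series `z' / (z' - z) = -∑_{n ≥ 1} (z' / z) ^ n`. -/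
theorem X_mul_inv_X_sub_C {K : Type*} [Field K] {z : K} (hz : z ≠ 0) :
    (X * (X - C z)⁻¹ : K⟦X⟧) = PowerSeries.mk fun n => if n = 0 then 0 else -z⁻¹ ^ n := by
  symm
  rw [PowerSeries.eq_mul_inv_iff_mul_eq (by simpa using hz)]
  ext n
  rw [mul_sub, map_sub, coeff_mul_C]
  rcases n with _ | _ | n
  · simp
  · rw [coeff_succ_mul_X, coeff_mk, coeff_mk, coeff_one_X]
    simp [hz]
  · rw [coeff_succ_mul_X, coeff_mk, coeff_mk, coeff_X]
    simp only [Nat.add_eq_zero_iff, one_ne_zero, and_false, ↓reduceIte, Nat.add_eq_right]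
    rw [pow_succ z⁻¹ (n + 1)]
    field_simp
    simp

variable {p : ℕ} [hp : Fact p.Prime] {α N : ℕ} {K : Type*} [NormedField K] [NormedAlgebra ℚ_[p] K]
  {ξ : K}

omit hp [NormedAlgebra ℚ_[p] K] in
theorem integralCoeff_form_root (hξ0 : ξ ≠ 0) (i : Fin N) {n : ℕ} (hn : 1 ≤ n) :
    integralCoeff (form p α ξ (Letter.root i)) n = (p : K) ^ α * -(ξ ^ (i : ℕ))⁻¹ ^ n / n := by
  rw [integralCoeff, form, X_mul_inv_X_sub_C (pow_ne_zero _ hξ0), PowerSeries.coeff_C_mul,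
    PowerSeries.coeff_mk, if_neg (by omega)]

omit [NormedAlgebra ℚ_[p] K] in
theorem integralCoeff_e0_mul (F : ZpN p N → K) {n : ℕ} (hn : 1 ≤ n) :
    integralCoeff (form p α ξ (Letter.e0 (N := N)) * series p F) n = (p : K) ^ α * F (n : ZpN p N) / n := by
  rw [integralCoeff, form, PowerSeries.coeff_C_mul, series, PowerSeries.coeff_mk,
    if_neg (by omega)]

omit [NormedAlgebra ℚ_[p] K] in
theorem integralCoeff_root_mul (hξ0 : ξ ≠ 0) (i : Fin N) (F : ZpN p N → K) (n : ℕ) :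
    integralCoeff (form p α ξ (Letter.root i) * series p F) n =
      (p : K) ^ α * (-∑ k ∈ Ico 1 n, (ξ ^ (i : ℕ))⁻¹ ^ (n - k) * F (k : ZpN p N)) / n := by
  rw [integralCoeff, form, X_mul_inv_X_sub_C (pow_ne_zero _ hξ0), mul_assoc, PowerSeries.coeff_C_mul,
    PowerSeries.coeff_mul]
  congr 2
  rw [Nat.sum_antidiagonal_eq_sum_range_succ_mk, ← sum_flip, ← sum_neg_distrib]
  simp only [series, PowerSeries.coeff_mk]
  refine (sum_subset_zero_on_sdiff (fun k hk => ?_) (fun k hk => ?_) fun k hk => ?_).symm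
  · have := mem_Ico.1 hk
    exact mem_range.2 (by omega)
  · have h1 := mem_sdiff.1 hk
    have h2 := mem_range.1 h1.1
    have h3 := mt mem_Ico.2 h1.2
    rcases Nat.eq_zero_or_pos k with h0 | h0
    · rw [if_pos (by omega : n - (n - k) = 0), mul_zero]
    · rw [if_pos (by omega : n - k = 0), zero_mul]
  · have h1 := mem_Ico.1 hk
    rw [if_neg (by omega), if_neg (by omega), Nat.sub_sub_self h1.2.le, neg_mul]

/-- A regularized iterated integral is determined by the word. -/
theorem IsRegInt.unique (hN : ¬ p ∣ N) (hξ : ξ ^ N = 1) (hα : 1 ≤ α)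
    [CompleteSpace K] :
    ∀ (w : List (Letter N)) {F F' : ZpN p N → K}, IsRegInt p α ξ w F → IsRegInt p α ξ w F' → F = F'
  | [], _, _, h, _ => h.elim
  | [_], _, _, h, h' => IsRegularization.unique hN hξ hα h h'
  | _ :: e' :: w, _, _, ⟨G, hG, h⟩, ⟨G', hG', h'⟩ => by
    obtain rfl := IsRegInt.unique hN hξ hα (e' :: w) hG hG'
    exact IsRegularization.unique hN hξ hα h h'

variable (p α ξ) in
/-- The word `w` has a regularized iterated integral, given by expansions whose coefficients have
polynomial growth and satisfy the bound `b`. -/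
def HasRegInt (w : List (Letter N)) (b : ℕ → ℝ) : Prop :=
  ∃ C : ℕ → Fin N → ℕ → K, FamGrowth p α C ∧ FamBound p α b C ∧ IsRegInt p α ξ w (extend p α ξ C)

theorem HasRegInt.congr {w : List (Letter N)} {b b' : ℕ → ℝ} (h : HasRegInt p α ξ w b)
    (hb : b = b') : HasRegInt p α ξ w b' := hb ▸ h

theorem seqExpansion_extend (hξ : ξ ^ N = 1) (n₀ : ℕ) (C : ℕ → Fin N → ℕ → K) :
    SeqExpansion p α ξ n₀ (fun n => extend p α ξ C (n : ZpN p N)) C :=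
  fun _ hr u _ => extend_natCast hξ C hr u

variable [IsUltrametricDist K] [CompleteSpace K]

/-- The iterated integral of one letter comes from the sequence `-ξ ^ (-i n)`, whose expansions are
constant. -/
theorem hasRegInt_root (hN : ¬ p ∣ N) (hξ : ξ ^ N = 1) (hα : 1 ≤ α) (i : Fin N) :
    HasRegInt p α ξ [Letter.root i] fun _ => (p : ℝ)⁻¹ := by
  have hN0 : N ≠ 0 := fun h => hN (h ▸ dvd_zero p)
  have hξ0 : ξ ≠ 0 := by rintro rfl; rw [zero_pow hN0] at hξ; exact zero_ne_one hξ
  set C : ℕ → Fin N → ℕ → K := fun _ j l => if j = i ∧ l = 0 then -1 else 0 with hC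
  have hb : ∀ r j l, ‖C r j l‖ ≤ if l = 0 then 1 else 0 := by
    intro r j l
    simp only [hC]
    split_ifs with h1 h2 h2 <;> simp_all
  have hbound : FamBound p α (fun _ => 1) C := by
    intro r _ j l
    refine (hb r j l).trans ?_
    split_ifs with h
    · subst h; simp
    · positivity
  have hgrowth : FamGrowth p α C :=
    famGrowth_of_bound (A := 1) zero_le_one (m := 0) (k := 0) (hbound.mono fun l => by simp)
  have hexp : SeqExpansion p α ξ 1 (fun n => -(ξ ^ (i : ℕ))⁻¹ ^ n) C := by
    intro r _ u _
    rw [sum_eq_single i]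
    · have : ev (C r i) ((p : K) ^ α * u) = -1 := by
        rw [ev, tsum_eq_single 0 fun l hl => by simp [hC, hl]]
        simp [hC]
      rw [this, mul_neg_one]
    · intro j _ hj
      have : ev (C r j) ((p : K) ^ α * u) = 0 := by
        rw [ev]; simp [hC, hj]
      rw [this, mul_zero]
    · simp
  refine ⟨divFam p α C, hgrowth.div hα, (hbound.div hα monotone_const).mono fun l => by simp, ?_⟩
  exact (hexp.div hα hgrowth fun n hn => integralCoeff_form_root hξ0 i hn).isRegularization_extend
    hξ hα (hgrowth.div hα)

/-- Integration of `p ^ α dz / z` improves the bound by `p`, at the cost of a shift of the index that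
comes from the disk around `0`. -/
theorem HasRegInt.e0 (hξ : ξ ^ N = 1) (hα : 1 ≤ α) {w : List (Letter N)} {b : ℕ → ℝ}
    (hb : Monotone b) (h : HasRegInt p α ξ w b) :
    HasRegInt p α ξ (Letter.e0 :: w) fun l => (p : ℝ)⁻¹ * b (l + 1) := by
  obtain ⟨C, hgrowth, hbound, hint⟩ := h
  refine ⟨divFam p α C, hgrowth.div hα, hbound.div hα hb, ?_⟩
  have hreg := ((seqExpansion_extend hξ 1 C).div hα hgrowth (g := integralCoeff
    (form p α ξ Letter.e0 * series p (extend p α ξ C))) fun n hn =>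
    integralCoeff_e0_mul _ hn).isRegularization_extend hξ hα (hgrowth.div hα)
  match w, hint with
  | _ :: _, hint => exact ⟨_, hint, hreg⟩

/-- A letter `e_{z_i}` is a multiplication by `z / (z - z_i)`, which introduces the denominators of the
power sums, followed by a letter `e_0`. -/
theorem HasRegInt.root (hN : ¬ p ∣ N) (hξ : ξ ^ N = 1) (hα : 1 ≤ α) {w : List (Letter N)}
    {b b' : ℕ → ℝ} (hb : Slow p b) (hb' : Monotone b')
    (hbb' : ∀ l, (p : ℝ) ^ (1 + padicValNat p l) * b l ≤ b' l) (h : HasRegInt p α ξ w b)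
    (i : Fin N) : HasRegInt p α ξ (Letter.root i :: w) fun l => (p : ℝ)⁻¹ * b' (l + 1) := by
  have hN0 : N ≠ 0 := fun h => hN (h ▸ dvd_zero p)
  have hξ0 : ξ ≠ 0 := by rintro rfl; rw [zero_pow hN0] at hξ; exact zero_ne_one hξ
  obtain ⟨C, hgrowth, hbound, hint⟩ := h
  have hgrowth' := hgrowth.mul hN hξ hα i
  refine ⟨divFam p α (mulCoeff p α ξ i C), hgrowth'.div hα,
    ((hbound.mul hN hξ hα hb i).mono hbb').div hα hb', ?_⟩
  have hreg := (((seqExpansion_extend hξ 0 C).mul hN hξ hα hgrowth i).div hα hgrowth'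
    (g := integralCoeff (form p α ξ (Letter.root i) * series p (extend p α ξ C))) fun n _ =>
    integralCoeff_root_mul hξ0 i _ n).isRegularization_extend hξ hα (hgrowth'.div hα)
  match w, hint with
  | _ :: _, hint => exact ⟨_, hint, hreg⟩

end IteratedIntegrals

/-! ### The explicit bound for the coefficients -/

section ExplicitBound

/-- The bound for the coefficients of the integral of a word of weight `S` and depth `k + 1`. For
`l + S ≤ A` it is `p ^ (k - S)`; beyond `A` it grows slowly enough to absorb the denominators of
the power sums without spoiling the convergence on the disks, `k ≤ d` being the bound for the slope. -/
noncomputable def wordBound (p A d k S l : ℕ) : ℝ :=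
  (p : ℝ) ^ ((k : ℝ) - S + k / d * ((l + S - A : ℕ) : ℝ))

variable {p A d : ℕ} [hp : Fact p.Prime]

/-- Compatibility of `wordBound` with the integration of `p ^ α dz / z`. -/
theorem wordBound_succ (k S l : ℕ) :
    (p : ℝ)⁻¹ * wordBound p A d k S (l + 1) = wordBound p A d k (S + 1) l := by
  have hp0 : (0 : ℝ) < p := by exact_mod_cast hp.out.pos
  rw [wordBound, wordBound, ← Real.rpow_neg_one, ← Real.rpow_add hp0, add_right_comm l 1 S,
    add_assoc l S 1]
  congr 1
  push_cast
  ring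

theorem slow_wordBound {k : ℕ} (hk : k ≤ d) (S : ℕ) : Slow p (wordBound p A d k S) where
  nonneg l := by unfold wordBound; positivity
  mono l l' hl := by
    refine Real.rpow_le_rpow_of_exponent_le (one_lt_prime_real p).le ?_
    have : ((l + S - A : ℕ) : ℝ) ≤ ((l' + S - A : ℕ) : ℝ) := by
      exact_mod_cast (by omega : l + S - A ≤ l' + S - A)
    gcongr
  succ_le l := by
    have hp0 : (0 : ℝ) < p := by exact_mod_cast hp.out.pos
    have h0 : ∀ y : ℝ, (p : ℝ) * (p : ℝ) ^ y = (p : ℝ) ^ (1 + y) := fun y => by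
      rw [Real.rpow_add hp0, Real.rpow_one]
    rw [wordBound, wordBound, h0]
    refine Real.rpow_le_rpow_of_exponent_le (one_lt_prime_real p).le ?_
    have h1 : ((l + 1 + S - A : ℕ) : ℝ) ≤ ((l + S - A : ℕ) : ℝ) + 1 := by
      exact_mod_cast (by omega : l + 1 + S - A ≤ (l + S - A) + 1)
    have h2 : (k : ℝ) / d ≤ 1 := div_le_one_of_le₀ (by exact_mod_cast hk) (by positivity)
    have h3 : (0 : ℝ) ≤ (k : ℝ) / d := by positivity
    nlinarith

/-- The valuation of `l` vanishes for `l < p`, and is at most `l / p` in general: hence it lies below a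
function that vanishes up to `A` and has slope `1 / d`. -/
theorem mul_padicValNat_le (h : A + d ≤ p) (l : ℕ) : d * padicValNat p l ≤ l - A := by
  rcases Nat.eq_zero_or_pos (padicValNat p l) with h0 | h0
  · simp [h0]
  have hl : l ≠ 0 := by rintro rfl; simp at h0
  set v := padicValNat p l
  have h1 : p ^ v ≤ l := Nat.le_of_dvd (Nat.pos_of_ne_zero hl) pow_padicValNat_dvd
  have h2 : p * v ≤ p ^ v := by
    obtain ⟨t, ht⟩ : ∃ t, v = t + 1 := ⟨v - 1, by omega⟩
    rw [ht, pow_succ, mul_comm]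
    exact Nat.mul_le_mul_right p (Nat.lt_pow_self hp.out.one_lt)
  have h3 : (A + d) * v ≤ p * v := Nat.mul_le_mul_right v h
  have h4 : A ≤ A * v := Nat.le_mul_of_pos_right A h0
  rw [add_mul] at h3
  omega

/-- Compatibility of `wordBound` with the multiplication by `z / (z - z_i)`. -/
theorem wordBound_mul (h : A + d ≤ p) {k : ℕ} (hk : k < d) (S l : ℕ) :
    (p : ℝ) ^ (1 + padicValNat p l) * wordBound p A d k S l ≤ wordBound p A d (k + 1) S l := by
  have hp0 : (0 : ℝ) < p := by exact_mod_cast hp.out.pos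
  have hd : (0 : ℝ) < d := by exact_mod_cast (by omega : 0 < d)
  rw [wordBound, wordBound, ← Real.rpow_natCast, ← Real.rpow_add hp0]
  refine Real.rpow_le_rpow_of_exponent_le (one_lt_prime_real p).le ?_
  have h1 : (padicValNat p l : ℝ) ≤ 1 / d * ((l + S - A : ℕ) : ℝ) := by
    rw [one_div, ← div_eq_inv_mul, le_div_iff₀ hd, mul_comm]
    exact_mod_cast (mul_padicValNat_le h l).trans (by omega)
  have h2 : ((k : ℝ) + 1) / d = k / d + 1 / d := add_div _ _ _
  push_cast
  rw [h2, add_mul]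
  linarith

/-- On the disks of radius `p ^ (-α)`, the excess of `wordBound` is absorbed by the powers of the
variable. -/
theorem wordBound_le {S : ℕ} (hA : S ≤ A) {k : ℕ} (hk : k ≤ d) (l : ℕ) :
    wordBound p A d k S l * (p : ℝ)⁻¹ ^ l ≤ (p : ℝ) ^ (-((S : ℤ) - k)) := by
  have hp0 : (0 : ℝ) < p := by exact_mod_cast hp.out.pos
  rw [wordBound, ← Real.rpow_intCast, inv_pow, ← Real.rpow_natCast, ← Real.rpow_neg hp0.le,
    ← Real.rpow_add hp0]
  refine Real.rpow_le_rpow_of_exponent_le (one_lt_prime_real p).le ?_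
  have h1 : ((l + S - A : ℕ) : ℝ) ≤ l := by exact_mod_cast (by omega : l + S - A ≤ l)
  have h2 : (k : ℝ) / d ≤ 1 := div_le_one_of_le₀ (by exact_mod_cast hk) (by positivity)
  have h3 : (0 : ℝ) ≤ ((l + S - A : ℕ) : ℝ) := Nat.cast_nonneg _
  have h4 : (0 : ℝ) ≤ (k : ℝ) / d := by positivity
  push_cast
  nlinarith

variable {α N : ℕ} {K : Type*} [NormedField K] [NormedAlgebra ℚ_[p] K] [IsUltrametricDist K]
  [CompleteSpace K] {ξ : K}

theorem HasRegInt.replicate_e0 (hξ : ξ ^ N = 1) (hα : 1 ≤ α) {w : List (Letter N)} {k S : ℕ}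
    (hk : k ≤ d) (h : HasRegInt p α ξ w (wordBound p A d k S)) (t : ℕ) :
    HasRegInt p α ξ (List.replicate t Letter.e0 ++ w) (wordBound p A d k (S + t)) := by
  induction t with
  | zero => exact h
  | succ t ih =>
    rw [List.replicate_succ, List.cons_append]
    refine (ih.e0 hξ hα (slow_wordBound hk _).mono).congr ?_
    funext l
    rw [wordBound_succ]
    rfl

theorem hasRegInt_word (hN : ¬ p ∣ N) (hξ : ξ ^ N = 1) (hα : 1 ≤ α) (h : A + d ≤ p) (w : Blocks N) :
    ∀ k, w.length = k + 1 → k ≤ d →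
      HasRegInt p α ξ w.word (wordBound p A d k w.weight) := by
  induction w with
  | nil => intro k hk; simp at hk
  | cons x w ih =>
    obtain ⟨s, i⟩ := x
    intro k hk hkd
    have hs : (s : ℕ) - 1 + 1 = s := Nat.sub_add_cancel s.pos
    have hword : Blocks.word ((s, i) :: w) =
        List.replicate ((s : ℕ) - 1) Letter.e0 ++ (Letter.root i :: Blocks.word w) := by
      simp [Blocks.word]
    have hweight : Blocks.weight ((s, i) :: w) = Blocks.weight w + 1 + ((s : ℕ) - 1) := by
      simp only [Blocks.weight, List.map_cons, List.sum_cons]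
      omega
    rw [hword, hweight]
    refine HasRegInt.replicate_e0 hξ hα hkd ?_ _
    rcases k with _ | k
    · obtain rfl : w = [] := List.length_eq_zero_iff.1 (by simpa using hk)
      refine (hasRegInt_root hN hξ hα i).congr ?_
      funext l
      simp [wordBound, Blocks.weight, Real.rpow_neg_one]
    · refine ((ih k (by simpa using hk) (by omega)).root hN hξ hα (slow_wordBound (by omega) _)
        (slow_wordBound hkd _).mono (fun l => wordBound_mul h (by omega) _ l) i).congr ?_
      funext l
      exact wordBound_succ _ _ _

/-- The integrality statement for all primes `p ≥ d + s`, where `s` is the weight. -/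
theorem isRegInt_word_bound {d : ℕ} {w : Blocks N} (hw : w.length = d + 1) (hN : ¬ p ∣ N)
    (hξ : ξ ^ N = 1) (hα : 1 ≤ α) (h : w.weight + d ≤ p) :
    (∃ F : ZpN p N → K, IsRegInt p α ξ w.word F) ∧
      ∀ F : ZpN p N → K, IsRegInt p α ξ w.word F →
        ∀ n : ZpN p N, ‖F n‖ ≤ (p : ℝ) ^ (-((w.weight : ℤ) - d)) := by
  obtain ⟨C, -, hbound, hint⟩ := hasRegInt_word hN hξ hα h w d hw le_rfl
  refine ⟨⟨_, hint⟩, fun F hF n => ?_⟩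
  obtain rfl := IsRegInt.unique hN hξ hα _ hF hint
  exact norm_extend_le hN hξ hα hbound (by positivity) (wordBound_le le_rfl le_rfl) n

end ExplicitBound

end RegIter

theorem corollary4p5 (N : ℕ) (hN : 1 ≤ N) (d : ℕ) (w : RegIter.Blocks N) (hw : w.length = d + 1) :
    -- parts (i) and (ii), for every prime number
    (∀ (p : ℕ) [Fact p.Prime], ¬ p ∣ N → ∀ (α : ℕ), 1 ≤ α →
      ∀ (K : Type*) [NormedField K] [NormedAlgebra ℚ_[p] K] [IsUltrametricDist K] [CompleteSpace K]
        (ξ : K), IsPrimitiveRoot ξ N →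
      ∀ (r : ℕ), r < p ^ α → ∀ (γ : List RegIter.Arrow), γ.length = d →
        (r ≠ 0 → γ ≠ List.replicate d RegIter.Arrow.carry) →
      ∀ (L : ℤ), -(d : ℤ) ≤ L → ∀ (e : ℤ) (l : ℕ) (i : Fin N),
        (RegIter.thresholdAt p d w.weight l e ≤ L →
          ‖RegIter.piece p α ξ w γ L r i l‖ ≤ (p : ℝ) ^ (-(e - ((α : ℤ) - 1) * l))) ∧
        ((L < RegIter.thresholdAt p d w.weight l e ∨
            0 ≤ e ∧ L < RegIter.threshold d w.weight l e) →
          max (RegIter.thresholdAt p d w.weight l e + w.weight + l)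
            (2 * RegIter.thresholdAt p d w.weight l e + 3) < p →
          ‖RegIter.piece p α ξ w γ L r i l‖ ≤
            (p : ℝ) ^ (-((w.weight : ℤ) - d - ((α : ℤ) - 1) * l)))) ∧
    -- part (iii), for `p` large enough
    (∃ p₀ : ℕ, ∀ (p : ℕ) [Fact p.Prime], p₀ ≤ p → ¬ p ∣ N → ∀ (α : ℕ), 1 ≤ α →
      ∀ (K : Type*) [NormedField K] [NormedAlgebra ℚ_[p] K] [IsUltrametricDist K] [CompleteSpace K]
        (ξ : K), IsPrimitiveRoot ξ N →
      (∃ F : RegIter.ZpN p N → K, RegIter.IsRegInt p α ξ w.word F) ∧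
      ∀ F : RegIter.ZpN p N → K, RegIter.IsRegInt p α ξ w.word F →
        ∀ n : RegIter.ZpN p N, ‖F n‖ ≤ (p : ℝ) ^ (-((w.weight : ℤ) - d))) := by
  refine ⟨?_, w.weight + d, ?_⟩
  · intro p _ hpN α hα K _ _ _ _ ξ hξ r hr γ hγ _ L hL e l i
    exact RegIter.norm_piece_le hw p hpN hα hξ.pow_eq_one hr hγ hL e l i
  · intro p _ hp hpN α hα K _ _ _ _ ξ hξ
    exact RegIter.isRegInt_word_bound hw hpN hξ.pow_eq_one hα hp
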